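/- Let $(a,b)\subseteq\mathbb R$ be a non-empty open interval, possibly unbounded, and let $\rho(z,\varepsilon)$ be a real function (for instance a polynomial) that is analytic near $(a,b)\times\{0\}$ and satisfies $\rho(z,0)>0$ on $(a,b)$. Let $C^\omega(a,b)$ be the complex-valued real-analytic functions on $(a,b)$. Functions $F(z,\varepsilon)$ are read as formal power series in $\varepsilon$ with coefficients in $C^\omega(a,b)$; in particular $\rho$ is replaced by its Taylor series in $\varepsilon$, and $F(z+c\,\varepsilon,\varepsilon)$ is expanded in powers of $\varepsilon$. *Noncommutative surface of rotation.* $\mathcal A_\rho$ is the complex algebra generated by $X_+,X_-$ and the elements $F(X_0,\varepsilon)$, $F\in C^\omega(a,b)[[\varepsilon]]$ (with $F\mapsto F(X_0,\varepsilon)$ an algebra homomorphism), subject to $F(X_0,\varepsilon)X_\pm=X_\pm F(X_0\pm\varepsilon,\varepsilon)$ (in particular $\varepsilon$ is central and $[X_0,X_\pm]=\pm\varepsilon X_\pm$) and $$[X_+,X_-]=\rho(X_0-\tfrac\varepsilon2,\varepsilon)-\rho(X_0+\tfrac\varepsilon2,\varepsilon),\qquad X_+X_-+X_-X_+=\rho(X_0-\tfrac\varepsilon2,\varepsilon)+\rho(X_0+\tfrac\varepsilon2,\varepsilon).$$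 Put $\mathcal A^0=\mathcal A_\rho/(\varepsilon)$, with quotient map $\pi$. *Heisenberg algebra.* $\mathcal H$ is the algebra of formal series $\sum_t\varepsilon^tu_t$, each $u_t$ a finite sum of terms $f(p)g(q)$ with $f\in C^\omega(a,b)$, $g\in C^\omega(\mathbb R)$, where $\varepsilon$ is central and $[q,p]=i\varepsilon$, that is, $g(q)f(p)=\sum_k\frac{(i\varepsilon)^k}{k!}f^{(k)}(p)g^{(k)}(q)$. Setting $\varepsilon=0$ gives the map $\pi$ of $\mathcal H$ onto the commutative algebra $\mathcal H^0$ of finite sums of functions $f(p)g(q)$. The Wick ordering $\Omega_W:\mathcal H^0\to\mathcal H$ is the linear map that sends $p^mq^n$ to the average of all distinct words with $m$ letters $p$ and $n$ letters $q$, and whose $\varepsilon^n$-coefficients, when values are written with $p$ to the left of $q$, are differential operators with coefficients in $\mathcal H^0$. *Theorem.* 1. The map $\Omega_W$ exists and is unique. There is a unique algebra homomorphism $\Psi:\mathcal A_\rho\to\mathcal H$ with $\Psi(\varepsilon)=\varepsilon$, $\Psi(F(X_0,\varepsilon))=F(p,\varepsilon)$ and $\Psi(X_\pm)=e^{\pm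 iq}\rho(p\pm\frac\varepsilon2,\varepsilon)^{1/2}$ (positive square root). Both $\Psi$ and the induced map $\Psi^0:\mathcal A^0\to\mathcal H^0$, $\Psi^0\circ\pi=\pi\circ\Psi$, are injective. 2. There is a unique linear map $\Omega_C:\mathcal A^0\to\mathcal A_\rho$ (the central ordering) such that $\Psi(\Omega_C(u))=e^{irq}f(p+\frac{r\varepsilon}2)$ whenever $\Psi^0(u)=e^{irq}f(p)$ with $r\in\mathbb Z$, $f\in C^\omega(a,b)$. It is an ordering: it is injective, $\pi\circ\Omega_C=\mathrm{id}$ and $\Omega_C(1)=1$. 3. $\Psi\circ\Omega_C=\Omega_W\circ\Psi^0$. 4. The central ordering gives the Vey product. For all $u,v\in\mathcal A^0$ there is a unique sequence $C_k(u,v)\in\mathcal A^0$ with $\Omega_C(u)\Omega_C(v)=\sum_k\varepsilon^k\,\Omega_C(C_k(u,v))$ (that is, for every $N$ the difference of the left side and the sum over $k<N$ lies in $\varepsilon^N\mathcal A_\rho$), and $$\Psi^0(C_k(u,v))=\frac1{k!}\Big(\frac i2P\Big)^k(\Psi^0u,\Psi^0v),\qquad P=\frac{\partial_1}{\partial q}\frac{\partial_2}{\partial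 p}-\frac{\partial_1}{\partial p}\frac{\partial_2}{\partial q},$$ the indices $1,2$ meaning differentiation of the first and second argument. Here $P$ is the Poisson bracket $\{\pi(x),\pi(y)\}=\pi\big(\frac1{i\varepsilon}[x,y]\big)$ of $\mathcal A^0$: for all $x,y\in\mathcal A_\rho$ there is $w$ with $[x,y]=i\varepsilon w$, and then $\Psi^0(\pi(w))=P(\Psi^0\pi(x),\Psi^0\pi(y))$. -/

import Mathlib

open scoped TensorProduct PowerSeries

/-! ### Analytic functions on an interval -/

/-- The open interval `(a, b)` of real numbers, with possibly infinite end points. -/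
def realIoo (a b : EReal) : Set ℝ := {z | a < (z : EReal) ∧ (z : EReal) < b}

theorem isOpen_realIoo (a b : EReal) : IsOpen (realIoo a b) :=
  (isOpen_lt continuous_const continuous_coe_real_ereal).inter
    (isOpen_lt continuous_coe_real_ereal continuous_const)

open Classical in
/-- Extension by zero of a function on `(a, b)`. -/
noncomputable def extZero {a b : EReal} (f : realIoo a b → ℂ) (t : ℝ) : ℂ :=
  if h : t ∈ realIoo a b then f ⟨t, h⟩ else 0

theorem extZero_eventuallyEq {a b : EReal} {f : realIoo a b → ℂ} {F : ℝ → ℂ}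
    (h : ∀ z : realIoo a b, f z = F z) {t : ℝ} (ht : t ∈ realIoo a b) :
    extZero f =ᶠ[nhds t] F := by
  filter_upwards [(isOpen_realIoo a b).mem_nhds ht] with s hs
  simp [extZero, hs, h]

theorem extZero_apply {a b : EReal} (f : realIoo a b → ℂ) (z : realIoo a b) :
    extZero f z = f z := by
  simp [extZero, z.2]

/-- `C^ω(a, b)`: the algebra of complex valued real-analytic functions on `(a, b)`. -/
noncomputable def AnFun (a b : EReal) : Subalgebra ℂ (realIoo a b → ℂ) where
  carrier := {f | AnalyticOnNhd ℝ (extZero f) (realIoo a b)}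
  mul_mem' {f g} hf hg t ht := by
    refine ((hf t ht).mul (hg t ht)).congr (extZero_eventuallyEq ?_ ht).symm
    intro z
    simp [extZero_apply]
  add_mem' {f g} hf hg t ht := by
    refine ((hf t ht).add (hg t ht)).congr (extZero_eventuallyEq ?_ ht).symm
    intro z
    simp [extZero_apply]
  algebraMap_mem' c t ht := by
    refine (analyticAt_const (v := c)).congr (extZero_eventuallyEq ?_ ht).symm
    intro z
    rfl

/-- A function which is analytic on `(a, b)`, as an element of `C^ω(a, b)`. -/
noncomputable def AnFun.of {a b : EReal} (F : ℝ → ℂ) (hF : AnalyticOnNhd ℝ F (realIoo a b)) :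
    AnFun a b :=
  ⟨fun z => F z, fun t ht => (hF t ht).congr (extZero_eventuallyEq (fun _ => rfl) ht).symm⟩

/-- The derivative on `C^ω(a, b)`. -/
noncomputable def AnFun.deriv {a b : EReal} : Derivation ℂ (AnFun a b) (AnFun a b) :=
  Derivation.mk'
    { toFun := fun f => AnFun.of (_root_.deriv (extZero f.1)) f.2.deriv
      map_add' := fun f g => by
        ext z
        change _root_.deriv (extZero (f.1 + g.1)) z
          = _root_.deriv (extZero f.1) z + _root_.deriv (extZero g.1) z
        rw [← deriv_add (f.2 z z.2).differentiableAt (g.2 z z.2).differentiableAt]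
        refine Filter.EventuallyEq.deriv_eq (extZero_eventuallyEq ?_ z.2)
        intro w
        simp [extZero_apply]
      map_smul' := fun c f => by
        ext z
        change _root_.deriv (extZero (c • f.1)) z = c * _root_.deriv (extZero f.1) z
        rw [← deriv_const_mul c (f.2 z z.2).differentiableAt]
        refine Filter.EventuallyEq.deriv_eq (extZero_eventuallyEq ?_ z.2)
        intro w
        simp [extZero_apply] }
    (fun f g => by
      ext z
      change _root_.deriv (extZero (f.1 * g.1)) z
        = f.1 z * _root_.deriv (extZero g.1) z + g.1 z * _root_.deriv (extZero f.1) z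
      have h := deriv_mul (f.2 z z.2).differentiableAt (g.2 z z.2).differentiableAt
      rw [extZero_apply, extZero_apply] at h
      rw [add_comm, mul_comm (g.1 z), ← h]
      refine Filter.EventuallyEq.deriv_eq (extZero_eventuallyEq ?_ z.2)
      intro w
      simp [extZero_apply])

/-- The coordinate function `z ↦ z` on `(a, b)`. -/
noncomputable def AnFun.coord (a b : EReal) : AnFun a b :=
  AnFun.of (fun t : ℝ => (t : ℂ)) fun t _ => Complex.ofRealCLM.analyticAt t

/-- The function `q ↦ e^{irq}` on the real line. -/
noncomputable def expFun (r : ℤ) : AnFun ⊥ ⊤ :=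
  AnFun.of (fun t : ℝ => Complex.exp (Complex.I * r * t)) fun t _ =>
    by
      have h : AnalyticAt ℝ (fun t : ℝ => Complex.I * r * (t : ℂ)) t :=
        analyticAt_const.mul (Complex.ofRealCLM.analyticAt t)
      exact (analyticAt_cexp.restrictScalars (𝕜 := ℝ)).comp h

/-- For a formal series `F(z, ε) = ∑ εⁿ Fₙ(z)` with `Fₙ ∈ C^ω(a, b)`, the series `F(z + cε, ε)`,
that is, `∑ ε^{k+l} cᵏ/k! F_l^{(k)}(z)`.  The variable of the formal series is `ε`. -/
noncomputable def epsShift {a b : EReal} (c : ℂ) (F : (AnFun a b)⟦X⟧) : (AnFun a b)⟦X⟧ :=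
  PowerSeries.mk fun n => ∑ kl ∈ Finset.HasAntidiagonal.antidiagonal n,
    (c ^ kl.1 / (kl.1.factorial : ℂ)) •
      ((AnFun.deriv (a := a) (b := b) : AnFun a b →ₗ[ℂ] AnFun a b) ^ kl.1)
        (PowerSeries.coeff kl.2 F)

theorem analyticAt_iteratedDeriv_snd (n : ℕ) {G : ℝ → ℝ → ℝ} {z e : ℝ}
    (hG : AnalyticAt ℝ (fun x : ℝ × ℝ => G x.1 x.2) (z, e)) :
    AnalyticAt ℝ (fun x : ℝ × ℝ => iteratedDeriv n (G x.1) x.2) (z, e) := by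
  induction n with
  | zero => simpa using hG
  | succ n ih =>
    have h : AnalyticAt ℝ (fun x : ℝ × ℝ =>
        fderiv ℝ (fun y : ℝ × ℝ => iteratedDeriv n (G y.1) y.2) x (0, 1)) (z, e) :=
      (ContinuousLinearMap.apply ℝ ℝ ((0 : ℝ), (1 : ℝ))).analyticAt _ |>.comp ih.fderiv
    refine h.congr ?_
    filter_upwards [ih.eventually_analyticAt] with x hx
    rw [iteratedDeriv_succ]
    have h1 : HasDerivAt (fun t : ℝ => (x.1, t)) ((0 : ℝ), (1 : ℝ)) x.2 :=
      (hasDerivAt_const _ _).prodMk (hasDerivAt_id _)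
    exact (hx.differentiableAt.hasFDerivAt.comp_hasDerivAt x.2 h1).deriv.symm

/-- The Taylor expansion in `ε` at `ε = 0` of a real function `ρ(z, ε)` which is analytic near
`(a, b) × {0}`: the formal series `∑ εⁿ (∂ⁿρ/∂εⁿ)(z, 0)/n!`. -/
noncomputable def epsTaylor {a b : EReal} (ρ : ℝ → ℝ → ℝ)
    (hρ : ∀ z ∈ realIoo a b, AnalyticAt ℝ (fun x : ℝ × ℝ => ρ x.1 x.2) (z, 0)) :
    (AnFun a b)⟦X⟧ :=
  PowerSeries.mk fun n =>
    AnFun.of (fun z => ((iteratedDeriv n (ρ z) 0 / (n.factorial : ℝ) : ℝ) : ℂ)) fun z hz =>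
      (Complex.ofRealCLM.analyticAt _).comp
        (((analyticAt_iteratedDeriv_snd n (hρ z hz)).comp
          (f := fun t : ℝ => (t, (0 : ℝ))) (analyticAt_id.prod analyticAt_const)).div_const)

/-- `s` is the positive square root of the formal series `F`: `s² = F`, and the leading
coefficient of `s` is a positive function. -/
def IsPosSqrt {a b : EReal} (s F : (AnFun a b)⟦X⟧) : Prop :=
  s * s = F ∧ ∀ z : realIoo a b, ∃ y : ℝ, 0 < y ∧ (PowerSeries.constantCoeff s).1 z = y

/-! ### The Heisenberg algebra with analytic functions of the generators -/

/-- The commutative algebra of finite sums of functions `f(p) g(q)`, with `f ∈ C^ω(a, b)` and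
`g ∈ C^ω(ℝ)`. -/
def Symb (a b : EReal) : Type := AnFun a b ⊗[ℂ] AnFun ⊥ ⊤

namespace Symb

noncomputable instance (a b : EReal) : CommRing (Symb a b) :=
  inferInstanceAs (CommRing (AnFun a b ⊗[ℂ] AnFun ⊥ ⊤))

noncomputable instance (a b : EReal) : Algebra ℂ (Symb a b) :=
  inferInstanceAs (Algebra ℂ (AnFun a b ⊗[ℂ] AnFun ⊥ ⊤))

variable {a b : EReal}

/-- The function `f(p) g(q)`. -/
noncomputable def tmul (f : AnFun a b) (g : AnFun ⊥ ⊤) : Symb a b := f ⊗ₜ[ℂ] g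

/-- The identification with the tensor product. -/
noncomputable def toTensor (a b : EReal) : Symb a b ≃ₐ[ℂ] AnFun a b ⊗[ℂ] AnFun ⊥ ⊤ :=
  (AlgEquiv.refl : (AnFun a b ⊗[ℂ] AnFun ⊥ ⊤) ≃ₐ[ℂ] AnFun a b ⊗[ℂ] AnFun ⊥ ⊤)

theorem toTensor_tmul (f : AnFun a b) (g : AnFun ⊥ ⊤) : toTensor a b (tmul f g) = f ⊗ₜ g := rfl

theorem toTensor_symm_tmul (f : AnFun a b) (g : AnFun ⊥ ⊤) :
    (toTensor a b).symm (f ⊗ₜ g) = tmul f g := rfl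

theorem tmul_mul_tmul (f f' : AnFun a b) (g g' : AnFun ⊥ ⊤) :
    tmul f g * tmul f' g' = tmul (f * f') (g * g') :=
  (toTensor a b).injective (by
    simp only [map_mul, toTensor_tmul, Algebra.TensorProduct.tmul_mul_tmul])

@[elab_as_elim]
theorem induction_on {motive : Symb a b → Prop} (u : Symb a b) (zero : motive 0)
    (tmul : ∀ f g, motive (tmul f g)) (add : ∀ u v, motive u → motive v → motive (u + v)) :
    motive u :=
  TensorProduct.induction_on (motive := motive) u zero tmul add

theorem add_tmul (f f' : AnFun a b) (g : AnFun ⊥ ⊤) :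
    tmul (f + f') g = tmul f g + tmul f' g := TensorProduct.add_tmul f f' g

theorem tmul_add (f : AnFun a b) (g g' : AnFun ⊥ ⊤) :
    tmul f (g + g') = tmul f g + tmul f g' := TensorProduct.tmul_add f g g'

/-- Functions of `p` alone. -/
noncomputable def ofP (a b : EReal) : AnFun a b →ₐ[ℂ] Symb a b :=
  (toTensor a b).symm.toAlgHom.comp Algebra.TensorProduct.includeLeft

end Symb

/-- `∂/∂p`. -/
noncomputable def dP (a b : EReal) : Symb a b →ₗ[ℂ] Symb a b :=
  (Symb.toTensor a b).symm.toLinearMap ∘ₗ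
    LinearMap.rTensor _ (AnFun.deriv (a := a) (b := b) : AnFun a b →ₗ[ℂ] AnFun a b) ∘ₗ
      (Symb.toTensor a b).toLinearMap

/-- `∂/∂q`. -/
noncomputable def dQ (a b : EReal) : Symb a b →ₗ[ℂ] Symb a b :=
  (Symb.toTensor a b).symm.toLinearMap ∘ₗ
    LinearMap.lTensor _ (AnFun.deriv (a := ⊥) (b := ⊤) : AnFun ⊥ ⊤ →ₗ[ℂ] AnFun ⊥ ⊤) ∘ₗ
      (Symb.toTensor a b).toLinearMap

theorem dP_tmul {a b : EReal} (f : AnFun a b) (g : AnFun ⊥ ⊤) :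
    dP a b (Symb.tmul f g) = Symb.tmul (AnFun.deriv f) g := rfl

theorem dQ_tmul {a b : EReal} (f : AnFun a b) (g : AnFun ⊥ ⊤) :
    dQ a b (Symb.tmul f g) = Symb.tmul f (AnFun.deriv g) := rfl

theorem dP_mul {a b : EReal} (u v : Symb a b) : dP a b (u * v) = dP a b u * v + u * dP a b v := by
  induction u using Symb.induction_on with
  | zero => simp
  | add u u' h h' => simp only [add_mul, map_add, h, h']; ring
  | tmul f g =>
    induction v using Symb.induction_on with
    | zero => simp
    | add v v' h h' => simp only [mul_add, map_add, h, h']; ring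
    | tmul f' g' =>
      simp only [dP_tmul, Symb.tmul_mul_tmul, Derivation.leibniz, smul_eq_mul, ← Symb.add_tmul]
      congr 1
      ring

theorem dQ_mul {a b : EReal} (u v : Symb a b) : dQ a b (u * v) = dQ a b u * v + u * dQ a b v := by
  induction u using Symb.induction_on with
  | zero => simp
  | add u u' h h' => simp only [add_mul, map_add, h, h']; ring
  | tmul f g =>
    induction v using Symb.induction_on with
    | zero => simp
    | add v v' h h' => simp only [mul_add, map_add, h, h']; ring
    | tmul f' g' =>
      simp only [dQ_tmul, Symb.tmul_mul_tmul, Derivation.leibniz, smul_eq_mul, ← Symb.tmul_add]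
      congr 1
      ring

theorem dP_dQ_comm (a b : EReal) : Commute (dP a b) (dQ a b) := by
  refine LinearMap.ext fun u => ?_
  rw [Module.End.mul_apply, Module.End.mul_apply]
  induction u using Symb.induction_on with
  | zero => simp
  | add u v h h' => simp only [map_add, h, h']
  | tmul f g => simp only [dP_tmul, dQ_tmul]

/-! ### Star products given by a pair of commuting derivations -/

theorem coeff_sum_antidiagonal {R : Type*} [CommRing R] (G : ℕ → ℕ → R⟦X⟧) {n N : ℕ} (h : n < N) :
    PowerSeries.coeff n (∑ k ∈ Finset.range N, ∑ ij ∈ Finset.HasAntidiagonal.antidiagonal k,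
        PowerSeries.X ^ k * G ij.1 ij.2) =
      PowerSeries.coeff n (∑ i ∈ Finset.range N, ∑ j ∈ Finset.range N,
        PowerSeries.X ^ (i + j) * G i j) := by
  rw [← Finset.sum_product', Finset.sum_sigma']
  have hs : (Finset.range N ×ˢ Finset.range N).filter (fun p => p.1 + p.2 < N) ⊆
      Finset.range N ×ˢ Finset.range N := Finset.filter_subset _ _
  rw [map_sum, map_sum, ← Finset.sum_subset hs]
  · refine Finset.sum_nbij' (fun x => x.2) (fun p => ⟨p.1 + p.2, p⟩) ?_ ?_ ?_ ?_ ?_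
    · rintro ⟨k, i, j⟩ hx
      simp only [Finset.mem_sigma, Finset.mem_range, Finset.HasAntidiagonal.mem_antidiagonal] at hx
      simp only [Finset.mem_filter, Finset.mem_product, Finset.mem_range]
      omega
    · rintro ⟨i, j⟩ hx
      simp only [Finset.mem_filter, Finset.mem_product, Finset.mem_range] at hx
      simp only [Finset.mem_sigma, Finset.mem_range, Finset.HasAntidiagonal.mem_antidiagonal]
      exact ⟨hx.2, trivial⟩
    · rintro ⟨k, i, j⟩ hx
      simp only [Finset.mem_sigma, Finset.mem_range, Finset.HasAntidiagonal.mem_antidiagonal] at hx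
      obtain ⟨_, rfl⟩ := hx
      rfl
    · rintro ⟨i, j⟩ _
      rfl
    · rintro ⟨k, i, j⟩ hx
      simp only [Finset.mem_sigma, Finset.mem_range, Finset.HasAntidiagonal.mem_antidiagonal] at hx
      obtain ⟨_, rfl⟩ := hx
      rfl
  · rintro ⟨i, j⟩ hp hq
    simp only [Finset.mem_filter, not_and, not_lt] at hq
    have := hq hp
    rw [PowerSeries.coeff_X_pow_mul', if_neg]
    simp only
    omega

theorem smul_choose_eq (c : ℂ) (i l j : ℕ) :
    c ^ (i + l) / ((i + l).factorial : ℂ) * (((i + l).choose i : ℕ) : ℂ) *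
        (c ^ j / (j.factorial : ℂ)) =
      c ^ (i + l + j) / ((i.factorial : ℂ) * (l.factorial : ℂ) * (j.factorial : ℂ)) := by
  have h1 : ((i + l).factorial : ℂ) ≠ 0 := by exact_mod_cast (i + l).factorial_ne_zero
  have h2 : (i.factorial : ℂ) ≠ 0 := by exact_mod_cast i.factorial_ne_zero
  have h3 : (l.factorial : ℂ) ≠ 0 := by exact_mod_cast l.factorial_ne_zero
  have h4 : (j.factorial : ℂ) ≠ 0 := by exact_mod_cast j.factorial_ne_zero
  have h5 : (((i + l).choose i : ℕ) : ℂ) * i.factorial * l.factorial = (i + l).factorial := by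
    rw [Nat.choose_symm_add]
    exact_mod_cast Nat.add_choose_mul_factorial_mul_factorial i l
  rw [← h5]
  have h6 : (((i + l).choose i : ℕ) : ℂ) ≠ 0 := by
    intro h0
    rw [h0] at h5
    exact h1 (by rw [← h5]; ring)
  field_simp
  ring

section StarProduct

variable {R : Type*} [CommRing R] [Algebra ℂ R]

/-- The coefficientwise action of a linear map on formal power series. -/
noncomputable def mapCoeff (d : R →ₗ[ℂ] R) : R⟦X⟧ →ₗ[ℂ] R⟦X⟧ where
  toFun u := PowerSeries.mk fun n => d (PowerSeries.coeff n u)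
  map_add' u v := by ext n; simp
  map_smul' c u := by ext n; simp

/-- The formal series `u ⋆ v = ∑ₖ εᵏ cᵏ/k! (Qᵏ u)(Pᵏ v)`. -/
noncomputable def starMul (c : ℂ) (P Q : R →ₗ[ℂ] R) (u v : R⟦X⟧) : R⟦X⟧ :=
  PowerSeries.mk fun n => ∑ kl ∈ Finset.HasAntidiagonal.antidiagonal n,
    (c ^ kl.1 / (kl.1.factorial : ℂ)) •
      PowerSeries.coeff kl.2 (mapCoeff (Q ^ kl.1) u * mapCoeff (P ^ kl.1) v)

theorem mapCoeff_pow (d : R →ₗ[ℂ] R) (k : ℕ) : mapCoeff (d ^ k) = mapCoeff d ^ k := by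
  induction k with
  | zero => ext u n; simp [mapCoeff]
  | succ k ih => rw [pow_succ', pow_succ', ← ih]; ext u n; simp [mapCoeff]

theorem mapCoeff_X_pow_mul (d : R →ₗ[ℂ] R) (N : ℕ) (u : R⟦X⟧) :
    mapCoeff d (PowerSeries.X ^ N * u) = PowerSeries.X ^ N * mapCoeff d u := by
  ext n
  simp only [mapCoeff, LinearMap.coe_mk, AddHom.coe_mk, PowerSeries.coeff_mk,
    PowerSeries.coeff_X_pow_mul']
  split_ifs <;> simp

theorem mapCoeff_mul {d : R →ₗ[ℂ] R} (hd : ∀ a b, d (a * b) = d a * b + a * d b) (u v : R⟦X⟧) :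
    mapCoeff d (u * v) = mapCoeff d u * v + u * mapCoeff d v := by
  ext n
  simp [mapCoeff, PowerSeries.coeff_mul, hd, Finset.sum_add_distrib]

theorem leibniz_pow_apply {S : Type*} [CommRing S] [Algebra ℂ S] {D : S →ₗ[ℂ] S}
    (hD : ∀ a b, D (a * b) = D a * b + a * D b) (k : ℕ) (u v : S) :
    (D ^ k) (u * v) = ∑ ij ∈ Finset.HasAntidiagonal.antidiagonal k,
      (k.choose ij.1) • ((D ^ ij.1) u * (D ^ ij.2) v) := by
  induction k with
  | zero => simp
  | succ k ih =>
    rw [pow_succ', Module.End.mul_apply, ih, map_sum,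
      Finset.sum_antidiagonal_choose_succ_nsmul (fun i j => (D ^ i) u * (D ^ j) v),
      ← Finset.sum_add_distrib]
    refine Finset.sum_congr rfl fun ij hij => ?_
    have hc : k.choose ij.1 = k.choose ij.2 := by
      rw [← Finset.HasAntidiagonal.mem_antidiagonal.mp hij, Nat.choose_symm_add]
    rw [map_nsmul, hD, pow_succ', pow_succ', ← hc]
    simp only [Module.End.mul_apply, nsmul_add]
    ring

theorem starMul_eq_trunc (c : ℂ) (P Q : R →ₗ[ℂ] R) (u v : R⟦X⟧) {n N : ℕ} (h : n < N) :
    PowerSeries.coeff n (starMul c P Q u v) =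
      PowerSeries.coeff n (∑ k ∈ Finset.range N, PowerSeries.X ^ k *
        ((c ^ k / (k.factorial : ℂ)) • ((mapCoeff Q ^ k) u * (mapCoeff P ^ k) v))) := by
  rw [starMul, PowerSeries.coeff_mk, Finset.Nat.sum_antidiagonal_eq_sum_range_succ_mk, map_sum]
  have hs : Finset.range n.succ ⊆ Finset.range N := Finset.range_subset_range.mpr h
  rw [← Finset.sum_subset hs]
  · refine Finset.sum_congr rfl fun k hk => ?_
    rw [PowerSeries.coeff_X_pow_mul', if_pos (Nat.lt_succ_iff.mp (Finset.mem_range.mp hk)),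
      mapCoeff_pow, mapCoeff_pow]
    simp
  · intro k _ hk
    rw [PowerSeries.coeff_X_pow_mul', if_neg]
    simpa [Nat.lt_succ_iff] using hk

theorem starMul_eq_add (c : ℂ) (P Q : R →ₗ[ℂ] R) (u v : R⟦X⟧) (N : ℕ) :
    ∃ z, starMul c P Q u v = (∑ k ∈ Finset.range N, PowerSeries.X ^ k *
        ((c ^ k / (k.factorial : ℂ)) • ((mapCoeff Q ^ k) u * (mapCoeff P ^ k) v)))
      + PowerSeries.X ^ N * z := by
  have h : (PowerSeries.X : R⟦X⟧) ^ N ∣ starMul c P Q u v - ∑ k ∈ Finset.range N,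
      PowerSeries.X ^ k *
        ((c ^ k / (k.factorial : ℂ)) • ((mapCoeff Q ^ k) u * (mapCoeff P ^ k) v)) := by
    rw [PowerSeries.X_pow_dvd_iff]
    intro m hm
    rw [map_sub, starMul_eq_trunc c P Q u v hm, sub_self]
  obtain ⟨z, hz⟩ := h
  exact ⟨z, by rw [← hz]; ring⟩

theorem starMul_assoc (c : ℂ) {P Q : R →ₗ[ℂ] R} (hP : ∀ a b, P (a * b) = P a * b + a * P b)
    (hQ : ∀ a b, Q (a * b) = Q a * b + a * Q b) (hPQ : Commute P Q) (u v w : R⟦X⟧) :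
    starMul c P Q (starMul c P Q u v) w = starMul c P Q u (starMul c P Q v w) := by
  have hP' := fun a b => mapCoeff_mul hP a b
  have hQ' := fun a b => mapCoeff_mul hQ a b
  have hc : Commute (mapCoeff P) (mapCoeff Q) := by
    ext s n
    simpa [mapCoeff] using LinearMap.congr_fun hPQ.eq (PowerSeries.coeff n s)
  have hXP : ∀ (k N : ℕ) (s : R⟦X⟧),
      (mapCoeff P ^ k) (PowerSeries.X ^ N * s) = PowerSeries.X ^ N * (mapCoeff P ^ k) s := by
    intro k N s
    rw [← mapCoeff_pow, mapCoeff_X_pow_mul]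
  have hXQ : ∀ (k N : ℕ) (s : R⟦X⟧),
      (mapCoeff Q ^ k) (PowerSeries.X ^ N * s) = PowerSeries.X ^ N * (mapCoeff Q ^ k) s := by
    intro k N s
    rw [← mapCoeff_pow, mapCoeff_X_pow_mul]
  ext n
  -- the common value of the two sides, up to terms of order `n + 1`
  let F : ℕ → ℕ → ℕ → R⟦X⟧ := fun i l j =>
    (c ^ (i + l + j) / ((i.factorial : ℂ) * (l.factorial : ℂ) * (j.factorial : ℂ))) •
      ((mapCoeff Q ^ (i + j)) u * (mapCoeff Q ^ l) ((mapCoeff P ^ j) v) *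
        (mapCoeff P ^ (i + l)) w)
  have key : ∀ (Z z : R⟦X⟧), PowerSeries.coeff n (Z + PowerSeries.X ^ (n + 1) * z) =
      PowerSeries.coeff n Z := by
    intro Z z
    rw [map_add, PowerSeries.coeff_X_pow_mul', if_neg (by omega), add_zero]
  have hL : PowerSeries.coeff n (starMul c P Q (starMul c P Q u v) w) =
      PowerSeries.coeff n (∑ j ∈ Finset.range (n + 1), ∑ i ∈ Finset.range (n + 1),
        ∑ l ∈ Finset.range (n + 1), PowerSeries.X ^ (i + l + j) * F i l j) := by
    obtain ⟨z, hz⟩ := starMul_eq_add c P Q u v (n + 1)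
    rw [starMul_eq_trunc c P Q _ w (Nat.lt_succ_self n), hz]
    have e1 : ∀ k, PowerSeries.X ^ k * ((c ^ k / (k.factorial : ℂ)) •
        ((mapCoeff Q ^ k) ((∑ j ∈ Finset.range (n + 1), PowerSeries.X ^ j *
          ((c ^ j / (j.factorial : ℂ)) • ((mapCoeff Q ^ j) u * (mapCoeff P ^ j) v)))
            + PowerSeries.X ^ (n + 1) * z) * (mapCoeff P ^ k) w)) =
        (∑ j ∈ Finset.range (n + 1), PowerSeries.X ^ j *
          ∑ il ∈ Finset.HasAntidiagonal.antidiagonal k, PowerSeries.X ^ k * F il.1 il.2 j)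
        + PowerSeries.X ^ (n + 1) * (PowerSeries.X ^ k * ((c ^ k / (k.factorial : ℂ)) •
          ((mapCoeff Q ^ k) z * (mapCoeff P ^ k) w))) := by
      intro k
      rw [map_add, hXQ, map_sum, add_mul, smul_add, mul_add]
      congr 1
      · rw [Finset.sum_mul, Finset.smul_sum, Finset.mul_sum]
        refine Finset.sum_congr rfl fun j _ => ?_
        rw [hXQ, map_smul, leibniz_pow_apply hQ', Finset.smul_sum, Finset.mul_sum,
          Finset.sum_mul, Finset.smul_sum, Finset.mul_sum, Finset.mul_sum]
        refine Finset.sum_congr rfl fun il hil => ?_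
        have hk : il.1 + il.2 = k := Finset.HasAntidiagonal.mem_antidiagonal.mp hil
        subst hk
        simp only [F]
        rw [← smul_choose_eq, pow_add (mapCoeff Q), ← Nat.cast_smul_eq_nsmul ℂ]
        simp only [Module.End.mul_apply, Algebra.smul_def, map_mul, map_natCast]
        ring
      · simp only [Algebra.smul_def]
        ring
    simp_rw [e1]
    rw [Finset.sum_add_distrib, ← Finset.mul_sum, key, Finset.sum_comm, map_sum, map_sum]
    refine Finset.sum_congr rfl fun j _ => ?_
    rw [← Finset.mul_sum]
    have e2 : (∑ i ∈ Finset.range (n + 1), ∑ l ∈ Finset.range (n + 1),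
        PowerSeries.X ^ (i + l + j) * F i l j) = PowerSeries.X ^ j *
        ∑ i ∈ Finset.range (n + 1), ∑ l ∈ Finset.range (n + 1),
          PowerSeries.X ^ (i + l) * F i l j := by
      simp only [Finset.mul_sum]
      refine Finset.sum_congr rfl fun i _ => Finset.sum_congr rfl fun l _ => ?_
      ring
    rw [e2, PowerSeries.coeff_X_pow_mul', PowerSeries.coeff_X_pow_mul']
    split_ifs with hj
    · exact coeff_sum_antidiagonal (fun i l => F i l j) (by omega)
    · rfl
  have hR : PowerSeries.coeff n (starMul c P Q u (starMul c P Q v w)) =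
      PowerSeries.coeff n (∑ l ∈ Finset.range (n + 1), ∑ j ∈ Finset.range (n + 1),
        ∑ i ∈ Finset.range (n + 1), PowerSeries.X ^ (i + l + j) * F i l j) := by
    obtain ⟨z, hz⟩ := starMul_eq_add c P Q v w (n + 1)
    rw [starMul_eq_trunc c P Q u _ (Nat.lt_succ_self n), hz]
    have e1 : ∀ k, PowerSeries.X ^ k * ((c ^ k / (k.factorial : ℂ)) •
        ((mapCoeff Q ^ k) u * (mapCoeff P ^ k) ((∑ l ∈ Finset.range (n + 1), PowerSeries.X ^ l *
          ((c ^ l / (l.factorial : ℂ)) • ((mapCoeff Q ^ l) v * (mapCoeff P ^ l) w)))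
            + PowerSeries.X ^ (n + 1) * z))) =
        (∑ l ∈ Finset.range (n + 1), PowerSeries.X ^ l *
          ∑ ji ∈ Finset.HasAntidiagonal.antidiagonal k, PowerSeries.X ^ k * F ji.2 l ji.1)
        + PowerSeries.X ^ (n + 1) * (PowerSeries.X ^ k * ((c ^ k / (k.factorial : ℂ)) •
          ((mapCoeff Q ^ k) u * (mapCoeff P ^ k) z))) := by
      intro k
      rw [map_add, hXP, map_sum, mul_add, smul_add, mul_add]
      congr 1
      · rw [Finset.mul_sum, Finset.smul_sum, Finset.mul_sum]
        refine Finset.sum_congr rfl fun l _ => ?_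
        rw [hXP, map_smul, leibniz_pow_apply hP', Finset.smul_sum, Finset.mul_sum,
          Finset.mul_sum, Finset.smul_sum, Finset.mul_sum, Finset.mul_sum]
        refine Finset.sum_congr rfl fun ji hji => ?_
        have hk : ji.1 + ji.2 = k := Finset.HasAntidiagonal.mem_antidiagonal.mp hji
        subst hk
        simp only [F]
        have hcomm : (mapCoeff P ^ ji.1) ((mapCoeff Q ^ l) v) =
            (mapCoeff Q ^ l) ((mapCoeff P ^ ji.1) v) :=
          LinearMap.congr_fun (hc.pow_pow ji.1 l).eq v
        have hco : c ^ (ji.2 + l + ji.1) /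
            ((ji.2.factorial : ℂ) * (l.factorial : ℂ) * (ji.1.factorial : ℂ)) =
            c ^ (ji.1 + ji.2) / ((ji.1 + ji.2).factorial : ℂ) *
              (((ji.1 + ji.2).choose ji.1 : ℕ) : ℂ) * (c ^ l / (l.factorial : ℂ)) := by
          rw [smul_choose_eq]
          congr 1 <;> ring
        rw [hco, ← Nat.cast_smul_eq_nsmul ℂ, hcomm, pow_add (mapCoeff P) ji.2,
          add_comm ji.2 ji.1]
        simp only [Module.End.mul_apply, Algebra.smul_def, map_mul, map_natCast]
        ring
      · simp only [Algebra.smul_def]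
        ring
    simp_rw [e1]
    rw [Finset.sum_add_distrib, ← Finset.mul_sum, key, Finset.sum_comm, map_sum, map_sum]
    refine Finset.sum_congr rfl fun l _ => ?_
    rw [← Finset.mul_sum]
    have e2 : (∑ j ∈ Finset.range (n + 1), ∑ i ∈ Finset.range (n + 1),
        PowerSeries.X ^ (i + l + j) * F i l j) = PowerSeries.X ^ l *
        ∑ j ∈ Finset.range (n + 1), ∑ i ∈ Finset.range (n + 1),
          PowerSeries.X ^ (j + i) * F i l j := by
      simp only [Finset.mul_sum]
      refine Finset.sum_congr rfl fun j _ => Finset.sum_congr rfl fun i _ => ?_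
      ring
    rw [e2, PowerSeries.coeff_X_pow_mul', PowerSeries.coeff_X_pow_mul']
    split_ifs with hl
    · exact coeff_sum_antidiagonal (fun j i => F i l j) (by omega)
    · rfl
  rw [hL, hR]
  congr 1
  rw [Finset.sum_comm]
  conv_rhs => rw [Finset.sum_comm' (t' := Finset.range (n + 1)) (s' := fun _ => Finset.range (n + 1)) (by simp)]
  rw [Finset.sum_comm]
  refine Finset.sum_congr rfl fun j _ => ?_
  rw [Finset.sum_comm]

end StarProduct

section StarProduct

variable {R : Type*} [CommRing R] [Algebra ℂ R]

theorem starMul_add (c : ℂ) (P Q : R →ₗ[ℂ] R) (u v w : R⟦X⟧) :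
    starMul c P Q u (v + w) = starMul c P Q u v + starMul c P Q u w := by
  ext n
  simp [starMul, mul_add, Finset.sum_add_distrib]

theorem add_starMul (c : ℂ) (P Q : R →ₗ[ℂ] R) (u v w : R⟦X⟧) :
    starMul c P Q (u + v) w = starMul c P Q u w + starMul c P Q v w := by
  ext n
  simp [starMul, add_mul, Finset.sum_add_distrib]

theorem starMul_smul (c : ℂ) (P Q : R →ₗ[ℂ] R) (t : ℂ) (u v : R⟦X⟧) :
    starMul c P Q u (t • v) = t • starMul c P Q u v := by
  ext n
  simp [starMul, Finset.smul_sum, smul_comm t]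

theorem smul_starMul (c : ℂ) (P Q : R →ₗ[ℂ] R) (t : ℂ) (u v : R⟦X⟧) :
    starMul c P Q (t • u) v = t • starMul c P Q u v := by
  ext n
  simp [starMul, Finset.smul_sum, smul_comm t]

theorem starMul_eq_mul_left (c : ℂ) (P Q : R →ₗ[ℂ] R) (u v : R⟦X⟧) (h : mapCoeff Q u = 0) :
    starMul c P Q u v = u * v := by
  ext n
  rw [starMul, PowerSeries.coeff_mk, Finset.sum_eq_single (0, n)]
  · rw [mapCoeff_pow, mapCoeff_pow]
    simp
  · rintro ⟨k, l⟩ hkl hne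
    rcases k with _ | k
    · refine absurd ?_ hne
      have := Finset.HasAntidiagonal.mem_antidiagonal.mp hkl
      simp only [zero_add] at this
      rw [this]
    · have h0 : mapCoeff (Q ^ (k + 1)) u = 0 := by
        rw [mapCoeff_pow, pow_succ, Module.End.mul_apply, h, map_zero]
      simp only [h0]
      simp
  · intro hn
    exact absurd (Finset.HasAntidiagonal.mem_antidiagonal.mpr (zero_add n)) hn

theorem starMul_eq_mul_right (c : ℂ) (P Q : R →ₗ[ℂ] R) (u v : R⟦X⟧) (h : mapCoeff P v = 0) :
    starMul c P Q u v = u * v := by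
  ext n
  rw [starMul, PowerSeries.coeff_mk, Finset.sum_eq_single (0, n)]
  · rw [mapCoeff_pow, mapCoeff_pow]
    simp
  · rintro ⟨k, l⟩ hkl hne
    rcases k with _ | k
    · refine absurd ?_ hne
      have := Finset.HasAntidiagonal.mem_antidiagonal.mp hkl
      simp only [zero_add] at this
      rw [this]
    · have h0 : mapCoeff (P ^ (k + 1)) v = 0 := by
        rw [mapCoeff_pow, pow_succ, Module.End.mul_apply, h, map_zero]
      simp only [h0]
      simp
  · intro hn
    exact absurd (Finset.HasAntidiagonal.mem_antidiagonal.mpr (zero_add n)) hn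

theorem mapCoeff_one {d : R →ₗ[ℂ] R} (hd : ∀ a b, d (a * b) = d a * b + a * d b) :
    mapCoeff d (1 : R⟦X⟧) = 0 := by
  have h := mapCoeff_mul hd 1 1
  simpa using h

end StarProduct

/-- The Heisenberg algebra of the strip `(a, b) × ℝ`: its elements are the formal series
`∑ₜ εᵗ uₜ`, where `uₜ` is a finite sum of terms `f(p) g(q)` with `f ∈ C^ω(a, b)` and
`g ∈ C^ω(ℝ)`, written with `p` to the left of `q`; the product is determined by
`g(q) f(p) = ∑ₖ (iε)ᵏ/k! f^{(k)}(p) g^{(k)}(q)`, that is, by `[q, p] = iε`. -/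
@[ext]
structure Heis (a b : EReal) : Type where
  /-- The normal ordered formal series of an element. -/
  symb : (Symb a b)⟦X⟧

namespace Heis

variable {a b : EReal}

theorem symb_injective : Function.Injective (symb : Heis a b → (Symb a b)⟦X⟧) :=
  fun _ _ h => Heis.ext h

noncomputable instance : Zero (Heis a b) := ⟨⟨0⟩⟩

noncomputable instance : One (Heis a b) := ⟨⟨1⟩⟩

noncomputable instance : Add (Heis a b) := ⟨fun u v => ⟨u.symb + v.symb⟩⟩

noncomputable instance : Neg (Heis a b) := ⟨fun u => ⟨-u.symb⟩⟩

noncomputable instance : Sub (Heis a b) := ⟨fun u v => ⟨u.symb - v.symb⟩⟩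

noncomputable instance : SMul ℕ (Heis a b) := ⟨fun n u => ⟨n • u.symb⟩⟩

noncomputable instance : SMul ℤ (Heis a b) := ⟨fun n u => ⟨n • u.symb⟩⟩

noncomputable instance : SMul ℂ (Heis a b) := ⟨fun t u => ⟨t • u.symb⟩⟩

noncomputable instance : Mul (Heis a b) :=
  ⟨fun u v => ⟨starMul Complex.I (dP a b) (dQ a b) u.symb v.symb⟩⟩

noncomputable instance : AddCommGroup (Heis a b) :=
  symb_injective.addCommGroup _ rfl (fun _ _ => rfl) (fun _ => rfl) (fun _ _ => rfl)
    (fun _ _ => rfl) (fun _ _ => rfl)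

/-- The additive bijection with formal series. -/
noncomputable def symbHom : Heis a b →+ (Symb a b)⟦X⟧ where
  toFun := symb
  map_zero' := rfl
  map_add' _ _ := rfl

noncomputable instance : Module ℂ (Heis a b) :=
  Function.Injective.module ℂ symbHom symb_injective (fun _ _ => rfl)

noncomputable instance : Ring (Heis a b) :=
  { (inferInstance : AddCommGroup (Heis a b)) with
    left_distrib := fun _ _ _ => Heis.ext (starMul_add _ _ _ _ _ _)
    right_distrib := fun _ _ _ => Heis.ext (add_starMul _ _ _ _ _ _)
    zero_mul := fun u => by
      have h := smul_starMul Complex.I (dP a b) (dQ a b) 0 0 u.symb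
      rw [zero_smul, zero_smul] at h
      exact Heis.ext h
    mul_zero := fun u => by
      have h := starMul_smul Complex.I (dP a b) (dQ a b) 0 u.symb 0
      rw [zero_smul, zero_smul] at h
      exact Heis.ext h
    mul_assoc := fun _ _ _ => Heis.ext (starMul_assoc _ dP_mul dQ_mul (dP_dQ_comm a b) _ _ _)
    one_mul := fun u => Heis.ext
      ((starMul_eq_mul_left _ _ _ 1 u.symb (mapCoeff_one dQ_mul)).trans (one_mul _))
    mul_one := fun u => Heis.ext
      ((starMul_eq_mul_right _ _ _ u.symb 1 (mapCoeff_one dP_mul)).trans (mul_one _)) }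

noncomputable instance : Algebra ℂ (Heis a b) :=
  Algebra.ofModule (fun t u v => Heis.ext (smul_starMul _ _ _ t u.symb v.symb))
    (fun t u v => Heis.ext (starMul_smul _ _ _ t u.symb v.symb))

/-- The central element `ε`. -/
noncomputable def eps (a b : EReal) : Heis a b := ⟨PowerSeries.X⟩

/-- The element `F(p, ε) = ∑ εⁿ Fₙ(p)`. -/
noncomputable def ofP (F : (AnFun a b)⟦X⟧) : Heis a b :=
  ⟨PowerSeries.map (Symb.ofP a b).toRingHom F⟩

/-- The element `g(q)`. -/
noncomputable def ofQ (g : AnFun ⊥ ⊤) : Heis a b :=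
  ⟨PowerSeries.C (Symb.tmul 1 g)⟩

/-- The generator `p`. -/
noncomputable def p (a b : EReal) : Heis a b := ofP (PowerSeries.C (AnFun.coord a b))

/-- The generator `q`. -/
noncomputable def q (a b : EReal) : Heis a b := ofQ (AnFun.coord ⊥ ⊤)

/-- Setting `ε = 0`: the homomorphism onto the commutative algebra of classical functions,
whose kernel is the ideal generated by `ε`. -/
noncomputable def classical (a b : EReal) : Heis a b →ₐ[ℂ] Symb a b :=
  AlgHom.ofLinearMap
    { toFun := fun u => PowerSeries.coeff 0 u.symb
      map_add' := fun _ _ => map_add _ _ _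
      map_smul' := fun _ _ => rfl }
    PowerSeries.coeff_zero_one
    (fun u v => by
      change PowerSeries.coeff 0 (starMul Complex.I (dP a b) (dQ a b) u.symb v.symb) =
        PowerSeries.coeff 0 u.symb * PowerSeries.coeff 0 v.symb
      simp [starMul, mapCoeff, PowerSeries.coeff_mul])

theorem eps_mul (u : Heis a b) : eps a b * u = ⟨PowerSeries.X * u.symb⟩ := by
  refine Heis.ext (starMul_eq_mul_left _ _ _ _ _ ?_)
  have h := mapCoeff_X_pow_mul (dQ a b) 1 1
  rw [mapCoeff_one dQ_mul, pow_one, mul_one, mul_zero] at h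
  exact h

theorem mul_eps (u : Heis a b) : u * eps a b = ⟨u.symb * PowerSeries.X⟩ := by
  refine Heis.ext (starMul_eq_mul_right _ _ _ _ _ ?_)
  have h := mapCoeff_X_pow_mul (dP a b) 1 1
  rw [mapCoeff_one dP_mul, pow_one, mul_one, mul_zero] at h
  exact h

theorem eps_central (u : Heis a b) : eps a b * u = u * eps a b := by
  rw [eps_mul, mul_eps, mul_comm]

theorem classical_eps : classical a b (eps a b) = 0 := PowerSeries.coeff_zero_X

theorem classical_eq_zero_iff (u : Heis a b) :
    classical a b u = 0 ↔ ∃ v, u = eps a b * v := by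
  constructor
  · intro h
    obtain ⟨s, hs⟩ := (PowerSeries.X_dvd_iff (φ := u.symb)).mpr
      (by rw [← PowerSeries.coeff_zero_eq_constantCoeff_apply]; exact h)
    exact ⟨⟨s⟩, by rw [eps_mul]; exact Heis.ext hs⟩
  · rintro ⟨v, rfl⟩
    rw [map_mul, classical_eps, zero_mul]

end Heis

/-! ### Wick ordering -/

/-- The sum of all distinct words consisting of `m` letters `x` and `n` letters `y`, divided by
the number `(m + n)!/(m! n!)` of these words. -/
noncomputable def symAverage {A : Type*} [Ring A] [Algebra ℂ A] (x y : A) (m n : ℕ) : A :=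
  (((m + n).choose m : ℕ) : ℂ)⁻¹ •
    ∑ w : Fin (m + n) → Bool with (Finset.univ.filter fun i => w i = true).card = m,
      (List.ofFn fun i => if w i = true then x else y).prod

/-- Wick ordering: on polynomials in `p, q` it is symmetrisation, and it is extended to analytic
functions by requiring every coefficient of its `ε`-expansion to be a differential operator. -/
structure IsWickOrdering {a b : EReal} (Ω : Symb a b →ₗ[ℂ] Heis a b) : Prop where
  monomial : ∀ m n : ℕ, Ω (Symb.tmul (AnFun.coord a b ^ m) (AnFun.coord ⊥ ⊤ ^ n)) =
    symAverage (Heis.p a b) (Heis.q a b) m n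
  differential : ∀ n : ℕ, ∃ (s : Finset (ℕ × ℕ)) (c : ℕ × ℕ → Symb a b), ∀ u : Symb a b,
    PowerSeries.coeff n (Ω u).symb =
      ∑ j ∈ s, c j * (dP a b ^ j.1) ((dQ a b ^ j.2) u)

/-! ### Noncommutative surfaces of rotation -/

/-- The generators `X₊`, `X₋` and `F(X₀, ε) = ∑ εⁿ Fₙ(X₀)` with `Fₙ ∈ C^ω(a, b)`. -/
inductive SurfGen (a b : EReal) : Type
  | plus : SurfGen a b
  | minus : SurfGen a b
  | fn (F : (AnFun a b)⟦X⟧) : SurfGen a b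

namespace SurfGen

variable {a b : EReal}

/-- `X₊` in the free algebra. -/
noncomputable abbrev xp : FreeAlgebra ℂ (SurfGen a b) := FreeAlgebra.ι ℂ plus

/-- `X₋` in the free algebra. -/
noncomputable abbrev xm : FreeAlgebra ℂ (SurfGen a b) := FreeAlgebra.ι ℂ minus

/-- `F(X₀, ε)` in the free algebra. -/
noncomputable abbrev x0 (F : (AnFun a b)⟦X⟧) : FreeAlgebra ℂ (SurfGen a b) :=
  FreeAlgebra.ι ℂ (fn F)

end SurfGen

open SurfGen in
/-- The relations of the noncommutative surface of rotation with profile `ρ(z, ε)`. The first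
three make `F ↦ F(X₀, ε)` an algebra homomorphism. The next two, `F(X₀, ε) X₊ = X₊ F(X₀ + ε, ε)`
and `F(X₀, ε) X₋ = X₋ F(X₀ - ε, ε)`, contain `[X₀, X₊] = ε X₊` and `[X₀, X₋] = -ε X₋` and the
centrality of `ε`. -/
inductive SurfRel {a b : EReal} (ρ : (AnFun a b)⟦X⟧) :
    FreeAlgebra ℂ (SurfGen a b) → FreeAlgebra ℂ (SurfGen a b) → Prop
  | add (F G : (AnFun a b)⟦X⟧) : SurfRel ρ (x0 (F + G)) (x0 F + x0 G)
  | mul (F G : (AnFun a b)⟦X⟧) : SurfRel ρ (x0 (F * G)) (x0 F * x0 G)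
  | const (c : ℂ) : SurfRel ρ (x0 (algebraMap ℂ _ c)) (algebraMap ℂ _ c)
  | fn_plus (F : (AnFun a b)⟦X⟧) : SurfRel ρ (x0 F * xp) (xp * x0 (epsShift 1 F))
  | fn_minus (F : (AnFun a b)⟦X⟧) : SurfRel ρ (x0 F * xm) (xm * x0 (epsShift (-1) F))
  | commutator : SurfRel ρ (xp * xm - xm * xp)
      (x0 (epsShift (-(1 / 2)) ρ) - x0 (epsShift (1 / 2) ρ))
  | anticommutator : SurfRel ρ (xp * xm + xm * xp)
      (x0 (epsShift (-(1 / 2)) ρ) + x0 (epsShift (1 / 2) ρ))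

/-- The noncommutative surface of rotation, enlarged by functions analytic in `X₀`: its elements
are the finite sums of `X₊ʳ F_r(X₀, ε)` and `X₋ʳ F_{-r}(X₀, ε)`. -/
abbrev SurfAlg {a b : EReal} (ρ : (AnFun a b)⟦X⟧) : Type := RingQuot (SurfRel ρ)

namespace SurfAlg

variable {a b : EReal} (ρ : (AnFun a b)⟦X⟧)

/-- The generator `X₊`. -/
noncomputable def plus : SurfAlg ρ := RingQuot.mkAlgHom ℂ (SurfRel ρ) SurfGen.xp

/-- The generator `X₋`. -/
noncomputable def minus : SurfAlg ρ := RingQuot.mkAlgHom ℂ (SurfRel ρ) SurfGen.xm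

/-- The element `F(X₀, ε)`. -/
noncomputable def fn (F : (AnFun a b)⟦X⟧) : SurfAlg ρ :=
  RingQuot.mkAlgHom ℂ (SurfRel ρ) (SurfGen.x0 F)

/-- The central element `ε`. -/
noncomputable def eps : SurfAlg ρ := fn ρ PowerSeries.X

/-- The commutative algebra `A⁰` obtained from the surface by setting `ε = 0`. -/
abbrev Classical : Type := RingQuot fun x y : SurfAlg ρ => x = eps ρ ∧ y = 0

/-- The quotient map `π : A → A⁰`. -/
noncomputable def toClassical : SurfAlg ρ →ₐ[ℂ] Classical ρ := RingQuot.mkAlgHom ℂ _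

end SurfAlg

section Orderings

variable {a b : EReal} {ρ : (AnFun a b)⟦X⟧}

/-- The Heisenberg coordinate homomorphism: `Ψ(ε) = ε`, `Ψ(F(X₀, ε)) = F(p, ε)` and
`Ψ(X_±) = e^{±iq} √ρ(p ± ε/2, ε)`. -/
structure IsHeisenbergCoord (Ψ : SurfAlg ρ →ₐ[ℂ] Heis a b) : Prop where
  map_eps : Ψ (SurfAlg.eps ρ) = Heis.eps a b
  map_fn : ∀ F, Ψ (SurfAlg.fn ρ F) = Heis.ofP F
  map_plus : ∃ s, IsPosSqrt s (epsShift (1 / 2) ρ) ∧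
    Ψ (SurfAlg.plus ρ) = Heis.ofQ (expFun 1) * Heis.ofP s
  map_minus : ∃ s, IsPosSqrt s (epsShift (-(1 / 2)) ρ) ∧
    Ψ (SurfAlg.minus ρ) = Heis.ofQ (expFun (-1)) * Heis.ofP s

/-- The homomorphism `Ψ⁰` of the commutative algebras induced by `Ψ`: the one with
`Ψ⁰ ∘ π = π ∘ Ψ`. -/
noncomputable def IsHeisenbergCoord.classical {Ψ : SurfAlg ρ →ₐ[ℂ] Heis a b}
    (h : IsHeisenbergCoord Ψ) : SurfAlg.Classical ρ →ₐ[ℂ] Symb a b :=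
  RingQuot.liftAlgHom ℂ ⟨(Heis.classical a b).comp Ψ, by
    rintro x y ⟨rfl, rfl⟩
    simp [h.map_eps, Heis.classical_eps]⟩

theorem IsHeisenbergCoord.classical_toClassical {Ψ : SurfAlg ρ →ₐ[ℂ] Heis a b}
    (h : IsHeisenbergCoord Ψ) (x : SurfAlg ρ) :
    h.classical (SurfAlg.toClassical ρ x) = Heis.classical a b (Ψ x) :=
  RingQuot.liftAlgHom_mkAlgHom_apply ℂ _ _ x

/-- An ordering: an injective linear section `Ω` of `π` with `Ω(1) = 1`. -/
structure IsOrdering (Ω : SurfAlg.Classical ρ →ₗ[ℂ] SurfAlg ρ) : Prop where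
  injective : Function.Injective Ω
  toClassical_apply : ∀ u, SurfAlg.toClassical ρ (Ω u) = u
  map_one : Ω 1 = 1

/-- The central ordering: if `Ψ⁰(u) = e^{irq} f(p)`, then `Ω(u)` is the element with
`Ψ(Ω(u)) = e^{irq} f(p + rε/2)`. -/
def IsCentralOrdering {Ψ : SurfAlg ρ →ₐ[ℂ] Heis a b} (h : IsHeisenbergCoord Ψ)
    (Ω : SurfAlg.Classical ρ →ₗ[ℂ] SurfAlg ρ) : Prop :=
  ∀ (u : SurfAlg.Classical ρ) (r : ℤ) (f : AnFun a b),
    h.classical u = Symb.tmul f (expFun r) →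
      Ψ (Ω u) = Heis.ofQ (expFun r) * Heis.ofP (epsShift ((r : ℂ) / 2) (PowerSeries.C f))

/-- `x = ∑ₖ εᵏ Ω(Cₖ)`, as an expansion in powers of `ε`. -/
def IsEpsExpansion (Ω : SurfAlg.Classical ρ →ₗ[ℂ] SurfAlg ρ) (x : SurfAlg ρ)
    (C : ℕ → SurfAlg.Classical ρ) : Prop :=
  ∀ N : ℕ, ∃ y : SurfAlg ρ,
    x = ∑ k ∈ Finset.range N, SurfAlg.eps ρ ^ k * Ω (C k) + SurfAlg.eps ρ ^ N * y

/-- The star product of the ordering `Ω`: `u ⋆ v = ∑ₖ εᵏ Cₖ`, where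
`Ω(u) Ω(v) = ∑ₖ εᵏ Ω(Cₖ)`. -/
def IsStarProduct (Ω : SurfAlg.Classical ρ →ₗ[ℂ] SurfAlg ρ) (u v : SurfAlg.Classical ρ)
    (C : ℕ → SurfAlg.Classical ρ) : Prop :=
  IsEpsExpansion Ω (Ω u * Ω v) C

end Orderings

/-! ### The Vey product -/

/-- The bidifferential operator `P = ∂₁/∂q ∂₂/∂p - ∂₁/∂p ∂₂/∂q`, acting on pairs of functions. -/
noncomputable def biP (a b : EReal) :
    Symb a b ⊗[ℂ] Symb a b →ₗ[ℂ] Symb a b ⊗[ℂ] Symb a b :=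
  TensorProduct.map (dQ a b) (dP a b) - TensorProduct.map (dP a b) (dQ a b)

/-- `Pᵏ(u, v)`. -/
noncomputable def biPow {a b : EReal} (k : ℕ) (u v : Symb a b) : Symb a b :=
  LinearMap.mul' ℂ (Symb a b) ((biP a b ^ k) (u ⊗ₜ v))

/-- The coefficient `(iP/2)ᵏ/k! (u, v)` of `εᵏ` in the Vey product `exp(iεP/2)(u, v)`. -/
noncomputable def veyCoeff {a b : EReal} (k : ℕ) (u v : Symb a b) : Symb a b :=
  ((Complex.I / 2) ^ k / (k.factorial : ℂ)) • biPow k u v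

open Finset.HasAntidiagonal (antidiagonal mem_antidiagonal)

/-!
Since `ρ(z, 0) > 0`, the series `ρ(X₀ + ε/2, ε)` has an invertible positive square root `T`, and
the polar decomposition `X₊ = E T`, `X₋ = T E⁻¹` shows that the surface is generated by the
functions `F(X₀, ε)` and a unit `E` with `F(X₀, ε) E = E F(X₀ + ε, ε)`. Its elements are therefore
Laurent sums `∑ F_r(X₀, ε) Eʳ`. The Heisenberg coordinates send `E` to `e^{iq}`, so they are
injective, even at `ε = 0`, by the linear independence of the functions `e^{irq}`.

The Wick ordering is `exp((iε/2) ∂²/∂p∂q)` followed by normal ordering. The star product of `ℋ` is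
`exp(iε ∂₁/∂q ∂₂/∂p)`, and on the tensor square all exponents commute; comparing them gives
`Ω_W(u) Ω_W(v) = Ω_W(exp(iεP/2)(u, v))`. As `P(u, uⁿ) = 0` for `u = sp + q`, the Wick ordering
preserves powers of `sp + q`, which makes it symmetrisation on monomials. By Taylor's formula it
sends `f(p) e^{irq}` to `e^{irq} f(p + rε/2)`; hence the central ordering is the Wick ordering
transported by the Heisenberg coordinates, and its star product is the Vey product.
-/

/-! ### Divided powers -/

section DivPow

variable {𝕜 A : Type*} [Field 𝕜] [Ring A] [Algebra 𝕜 A]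

variable (𝕜) in
/-- The divided power `xⁿ / n!`, the `n`-th coefficient of the exponential series of `x`. -/
noncomputable def divPow (x : A) (n : ℕ) : A :=
  (n.factorial : 𝕜)⁻¹ • x ^ n

theorem divPow_zero (x : A) : divPow 𝕜 x 0 = 1 := by simp [divPow]

theorem divPow_smul (c : 𝕜) (x : A) (n : ℕ) :
    divPow 𝕜 (c • x) n = (c ^ n / (n.factorial : 𝕜)) • x ^ n := by
  rw [divPow, smul_pow, smul_smul, div_eq_inv_mul]

theorem map_divPow {B : Type*} [Ring B] [Algebra 𝕜 B] (f : A →ₐ[𝕜] B) (x : A) (n : ℕ) :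
    f (divPow 𝕜 x n) = divPow 𝕜 (f x) n := by
  simp [divPow]

theorem commute_divPow {x y : A} (h : Commute x y) (m n : ℕ) :
    Commute (divPow 𝕜 x m) (divPow 𝕜 y n) :=
  ((h.pow_pow m n).smul_left _).smul_right _

theorem divPow_add [CharZero 𝕜] {x y : A} (h : Commute x y) (n : ℕ) :
    divPow 𝕜 (x + y) n =
      ∑ ij ∈ antidiagonal n, divPow 𝕜 x ij.1 * divPow 𝕜 y ij.2 := by
  rw [divPow, h.add_pow', Finset.smul_sum]
  refine Finset.sum_congr rfl fun ⟨i, j⟩ hij => ?_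
  obtain rfl : i + j = n := mem_antidiagonal.mp hij
  have hfac (k : ℕ) : (k.factorial : 𝕜) ≠ 0 := by exact_mod_cast k.factorial_ne_zero
  rw [divPow, divPow, smul_mul_smul_comm, ← Nat.cast_smul_eq_nsmul 𝕜, smul_smul,
    Nat.cast_add_choose]
  congr 1
  field_simp [hfac (i + j)]

theorem divPow_apply_comm {M N : Type*} [AddCommGroup M] [Module 𝕜 M] [AddCommGroup N]
    [Module 𝕜 N] {f : M →ₗ[𝕜] N} {D : Module.End 𝕜 M} {E : Module.End 𝕜 N}
    (h : ∀ u, E (f u) = f (D u)) (n : ℕ) (u : M) :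
    divPow 𝕜 E n (f u) = f (divPow 𝕜 D n u) := by
  have hpow : (E ^ n) (f u) = f ((D ^ n) u) :=
    LinearMap.congr_fun (Module.End.commute_pow_left_of_commute (LinearMap.ext h) n) u
  simp only [divPow, LinearMap.smul_apply, hpow, map_smul]

theorem pow_apply_of_apply_eq_smul {M : Type*} [AddCommGroup M] [Module 𝕜 M]
    {D : Module.End 𝕜 M} {u : M} {c : 𝕜} (h : D u = c • u) (n : ℕ) : (D ^ n) u = c ^ n • u := by
  induction n with
  | zero => simp
  | succ n ih => rw [pow_succ, Module.End.mul_apply, h, map_smul, ih, smul_smul, ← pow_succ']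

theorem divPow_apply_of_apply_eq_smul {M : Type*} [AddCommGroup M] [Module 𝕜 M]
    {D : Module.End 𝕜 M} {u : M} {c : 𝕜} (h : D u = c • u) (n : ℕ) :
    divPow 𝕜 D n u = (c ^ n / (n.factorial : 𝕜)) • u := by
  rw [divPow, LinearMap.smul_apply, pow_apply_of_apply_eq_smul h, smul_smul, div_eq_inv_mul]

theorem divPow_apply_of_apply_eq_zero {M : Type*} [AddCommGroup M] [Module 𝕜 M]
    {D : Module.End 𝕜 M} {u : M} (h : D u = 0) {n : ℕ} (hn : n ≠ 0) : divPow 𝕜 D n u = 0 := by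
  rw [divPow_apply_of_apply_eq_smul (c := 0) (by rw [h, zero_smul]), zero_pow hn, zero_div,
    zero_smul]

end DivPow

/-! ### Exponentials of a second-order operator and the Moyal product -/

section Moyal

variable {R : Type*} [CommRing R] [Algebra ℂ R]

/-- The exponential `u ↦ exp(εD) u` of an operator, with values in formal series in `ε`. -/
noncomputable def expSeries (D : R →ₗ[ℂ] R) : R →ₗ[ℂ] R⟦X⟧ where
  toFun u := PowerSeries.mk fun n => divPow ℂ (A := Module.End ℂ R) D n u
  map_add' u v := by ext n; simp
  map_smul' c u := by ext n; simp

theorem coeff_expSeries (D : R →ₗ[ℂ] R) (u : R) (n : ℕ) :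
    PowerSeries.coeff n (expSeries D u) = divPow ℂ (A := Module.End ℂ R) D n u :=
  PowerSeries.coeff_mk n fun n => divPow ℂ (A := Module.End ℂ R) D n u

theorem expSeries_of_apply_eq_zero {D : R →ₗ[ℂ] R} {u : R} (h : D u = 0) :
    expSeries D u = PowerSeries.C u := by
  ext n
  rw [coeff_expSeries, PowerSeries.coeff_C]
  split_ifs with hn
  · rw [hn, divPow_zero, Module.End.one_apply]
  · exact divPow_apply_of_apply_eq_zero h hn

theorem coeff_mapCoeff (D : R →ₗ[ℂ] R) (u : R⟦X⟧) (n : ℕ) :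
    PowerSeries.coeff n (mapCoeff D u) = D (PowerSeries.coeff n u) :=
  PowerSeries.coeff_mk n fun n => D (PowerSeries.coeff n u)

/-- The bidifferential operator `(u, v) ↦ Qu Pv - Pu Qv` on the tensor square. -/
noncomputable def bracketOp (P Q : Module.End ℂ R) : Module.End ℂ (R ⊗[ℂ] R) :=
  TensorProduct.map Q P - TensorProduct.map P Q

/-- The operator `D ⊗ 1 + 1 ⊗ D`, which a derivation `D` intertwines with itself through the
multiplication map. -/
noncomputable def leibnizLift (D : Module.End ℂ R) : Module.End ℂ (R ⊗[ℂ] R) :=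
  TensorProduct.map D 1 + TensorProduct.map 1 D

theorem apply_mul'_eq_mul'_leibnizLift {D : Module.End ℂ R}
    (hD : ∀ u v, D (u * v) = D u * v + u * D v) (z : R ⊗[ℂ] R) :
    D (LinearMap.mul' ℂ R z) = LinearMap.mul' ℂ R (leibnizLift D z) := by
  induction z using TensorProduct.induction_on with
  | zero => simp
  | add z w hz hw => simp only [map_add, hz, hw]
  | tmul u v => simp [leibnizLift, hD]

theorem commute_tensorMap {f f' g g' : Module.End ℂ R} (hf : Commute f f') (hg : Commute g g') :
    Commute (TensorProduct.map f g : Module.End ℂ (R ⊗[ℂ] R)) (TensorProduct.map f' g') := by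
  rw [commute_iff_eq, ← TensorProduct.map_mul, ← TensorProduct.map_mul, hf.eq, hg.eq]

theorem commute_tensorMap_leibnizLift {f g D : Module.End ℂ R} (hf : Commute f D)
    (hg : Commute g D) :
    Commute (TensorProduct.map f g : Module.End ℂ (R ⊗[ℂ] R)) (leibnizLift D) :=
  (commute_tensorMap hf (Commute.one_right g)).add_right
    (commute_tensorMap (Commute.one_right f) hg)

variable {P Q : Module.End ℂ R}

theorem commute_leibnizLift_mul_bracketOp (h : Commute P Q) :
    Commute (leibnizLift P * leibnizLift Q) (bracketOp P Q) :=
  (((commute_tensorMap_leibnizLift h.symm (.refl P)).mul_right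
      (commute_tensorMap_leibnizLift (.refl Q) h)).sub_left
    ((commute_tensorMap_leibnizLift (.refl P) h.symm).mul_right
      (commute_tensorMap_leibnizLift h (.refl Q)))).symm

theorem leibnizLift_mul_leibnizLift (P Q : Module.End ℂ R) :
    leibnizLift P * leibnizLift Q =
      leibnizLift (P * Q) + TensorProduct.map P Q + TensorProduct.map Q P := by
  simp only [leibnizLift, add_mul, mul_add, ← TensorProduct.map_mul, mul_one, one_mul]
  abel

theorem moyal_exponent_eq (c : ℂ) (P Q : Module.End ℂ R) :
    c • (TensorProduct.map Q P : Module.End ℂ (R ⊗[ℂ] R)) + leibnizLift ((c / 2) • (P * Q)) =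
      (c / 2) • bracketOp P Q + (c / 2) • (leibnizLift P * leibnizLift Q) := by
  have hsmul : leibnizLift ((c / 2) • (P * Q)) = (c / 2) • leibnizLift (P * Q) := by
    simp only [leibnizLift, TensorProduct.map_smul_left, TensorProduct.map_smul_right, smul_add]
  rw [leibnizLift_mul_leibnizLift, hsmul, bracketOp]
  module

theorem divPow_leibnizLift_tmul (D : Module.End ℂ R) (n : ℕ) (u v : R) :
    divPow ℂ (leibnizLift D) n (u ⊗ₜ v) =
      ∑ ij ∈ antidiagonal n, divPow ℂ D ij.1 u ⊗ₜ divPow ℂ D ij.2 v := by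
  have hleft (n : ℕ) : divPow ℂ (TensorProduct.map D 1) n = TensorProduct.map (divPow ℂ D n) 1 :=
    (map_divPow (Module.End.rTensorAlgHom ℂ R R) D n).symm
  have hright (n : ℕ) :
      divPow ℂ (TensorProduct.map 1 D) n = TensorProduct.map 1 (divPow ℂ D n) :=
    (map_divPow (Module.End.lTensorAlgHom ℂ R R) D n).symm
  rw [leibnizLift, divPow_add (commute_tensorMap (.one_right D) (.one_left D)),
    LinearMap.sum_apply]
  refine Finset.sum_congr rfl fun ij _ => ?_
  rw [hleft, hright, ← TensorProduct.map_mul, mul_one, one_mul, TensorProduct.map_tmul]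

theorem coeff_starMul_expSeries (c : ℂ) {D : Module.End ℂ R} (hP : Commute P D)
    (hQ : Commute Q D) (u v : R) (n : ℕ) :
    PowerSeries.coeff n (starMul c P Q (expSeries D u) (expSeries D v)) =
      LinearMap.mul' ℂ R (divPow ℂ (c • (TensorProduct.map Q P : Module.End ℂ (R ⊗[ℂ] R)) +
        leibnizLift D) n (u ⊗ₜ v)) := by
  have hcomm : Commute (c • (TensorProduct.map Q P : Module.End ℂ (R ⊗[ℂ] R))) (leibnizLift D) :=
    (commute_tensorMap_leibnizLift hQ hP).smul_left c
  rw [divPow_add hcomm, LinearMap.sum_apply, map_sum, starMul, PowerSeries.coeff_mk]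
  refine Finset.sum_congr rfl fun ⟨k, l⟩ _ => ?_
  rw [Module.End.mul_apply, divPow_leibnizLift_tmul, divPow_smul, TensorProduct.map_pow,
    LinearMap.smul_apply, map_smul, map_sum, map_sum, PowerSeries.coeff_mul]
  congr 1
  refine Finset.sum_congr rfl fun ij _ => ?_
  rw [coeff_mapCoeff, coeff_mapCoeff, coeff_expSeries, coeff_expSeries, TensorProduct.map_tmul,
    LinearMap.mul'_apply]

theorem coeff_starMul_expSeries_eq_sum (c : ℂ) (hP : ∀ u v, P (u * v) = P u * v + u * P v)
    (hQ : ∀ u v, Q (u * v) = Q u * v + u * Q v) (hPQ : Commute P Q) (u v : R) (n : ℕ) :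
    PowerSeries.coeff n (starMul c P Q (expSeries ((c / 2) • (P * Q)) u)
        (expSeries ((c / 2) • (P * Q)) v)) =
      ∑ kl ∈ antidiagonal n, PowerSeries.coeff kl.2 (expSeries ((c / 2) • (P * Q))
        (LinearMap.mul' ℂ R (divPow ℂ ((c / 2) • bracketOp P Q) kl.1 (u ⊗ₜ v)))) := by
  have hmul (z : R ⊗[ℂ] R) : ((c / 2) • (P * Q)) (LinearMap.mul' ℂ R z) =
      LinearMap.mul' ℂ R (((c / 2) • (leibnizLift P * leibnizLift Q)) z) := by
    simp only [LinearMap.smul_apply, Module.End.mul_apply, map_smul,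
      apply_mul'_eq_mul'_leibnizLift hP, apply_mul'_eq_mul'_leibnizLift hQ]
  have hcomm : Commute ((c / 2) • bracketOp P Q) ((c / 2) • (leibnizLift P * leibnizLift Q)) :=
    ((commute_leibnizLift_mul_bracketOp hPQ).symm.smul_left _).smul_right _
  rw [coeff_starMul_expSeries c (((Commute.refl P).mul_right hPQ).smul_right _)
    ((hPQ.symm.mul_right (.refl Q)).smul_right _), moyal_exponent_eq, divPow_add hcomm,
    LinearMap.sum_apply, map_sum]
  refine Finset.sum_congr rfl fun kl _ => ?_
  rw [coeff_expSeries, divPow_apply_comm hmul, (commute_divPow hcomm _ _).eq,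
    Module.End.mul_apply]

end Moyal

/-! ### Exponential functions and the Heisenberg algebra -/

section Functions

/-- The function `q ↦ e^{icq}` with a complex frequency `c`. -/
noncomputable def expC (c : ℂ) : AnFun ⊥ ⊤ :=
  AnFun.of (fun t : ℝ => Complex.exp (Complex.I * c * t)) fun t _ =>
    (analyticAt_cexp.restrictScalars (𝕜 := ℝ)).comp
      (analyticAt_const.mul (Complex.ofRealCLM.analyticAt t))

theorem expFun_eq_expC (r : ℤ) : expFun r = expC r := rfl

theorem expC_apply (c : ℂ) (t : realIoo ⊥ ⊤) :
    (expC c).1 t = Complex.exp (Complex.I * c * (t : ℝ)) := rfl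

theorem expC_zero : expC 0 = 1 := by
  ext t
  rw [expC_apply, mul_zero, zero_mul, Complex.exp_zero]
  rfl

theorem expC_add (c d : ℂ) : expC (c + d) = expC c * expC d := by
  ext t
  change (expC (c + d)).1 t = (expC c).1 t * (expC d).1 t
  rw [expC_apply, expC_apply, expC_apply, ← Complex.exp_add, mul_add, add_mul]

theorem expC_ne_zero (c : ℂ) : expC c ≠ 0 := fun h =>
  Complex.exp_ne_zero _
    (congrFun (congrArg Subtype.val h) ⟨0, EReal.bot_lt_coe _, EReal.coe_lt_top _⟩)

theorem AnFun.deriv_apply {a b : EReal} {f : AnFun a b} {F F' : ℝ → ℂ} (hf : ∀ z, f.1 z = F z)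
    (hF : ∀ t, HasDerivAt F (F' t) t) (z : realIoo a b) : (AnFun.deriv f).1 z = F' z :=
  (extZero_eventuallyEq hf z.2).deriv_eq.trans (hF z).deriv

theorem deriv_expC (c : ℂ) : AnFun.deriv (expC c) = (Complex.I * c) • expC c := by
  ext z
  refine AnFun.deriv_apply (F := fun t => Complex.exp (Complex.I * c * t)) (expC_apply c)
    (F' := fun t => Complex.I * c * Complex.exp (Complex.I * c * t)) (fun t => ?_) z
  have hlin : HasDerivAt (fun t : ℝ => Complex.I * c * (t : ℂ)) (Complex.I * c) t := by
    simpa using (Complex.ofRealCLM.hasDerivAt (x := t)).const_mul (Complex.I * c)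
  simpa only [mul_comm] using hlin.cexp

theorem deriv_coord (a b : EReal) : AnFun.deriv (AnFun.coord a b) = 1 := by
  ext z
  exact AnFun.deriv_apply (F := fun t => (t : ℂ)) (F' := fun _ => 1) (fun _ => rfl)
    (fun t => Complex.ofRealCLM.hasDerivAt.congr_deriv Complex.ofReal_one) z

/-- The derivative as an element of the endomorphism algebra. -/
noncomputable abbrev AnFun.derivEnd (a b : EReal) : Module.End ℂ (AnFun a b) :=
  (AnFun.deriv : Derivation ℂ (AnFun a b) (AnFun a b)).toLinearMap

theorem linearIndependent_expC : LinearIndependent ℂ expC :=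
  Module.End.eigenvectors_linearIndependent' (AnFun.derivEnd ⊥ ⊤)
    (fun c => Complex.I * c) (mul_right_injective₀ Complex.I_ne_zero) expC
    fun c => ⟨Module.End.mem_eigenspace_iff.mpr (deriv_expC c), expC_ne_zero c⟩

end Functions

variable {a b : EReal}

namespace Symb

theorem one_def : (1 : Symb a b) = tmul 1 1 := rfl

theorem smul_tmul (c : ℂ) (f : AnFun a b) (g : AnFun ⊥ ⊤) : tmul (c • f) g = c • tmul f g :=
  (TensorProduct.smul_tmul' c f g).symm

theorem tmul_smul (c : ℂ) (f : AnFun a b) (g : AnFun ⊥ ⊤) : tmul f (c • g) = c • tmul f g :=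
  TensorProduct.tmul_smul c f g

theorem zero_tmul (g : AnFun ⊥ ⊤) : tmul (0 : AnFun a b) g = 0 := TensorProduct.zero_tmul _ g

theorem tmul_zero (f : AnFun a b) : tmul f 0 = 0 := TensorProduct.tmul_zero _ f

/-- The linear map `f ↦ f(p) g(q)`. -/
noncomputable def tmulRight (g : AnFun ⊥ ⊤) : AnFun a b →ₗ[ℂ] Symb a b where
  toFun f := tmul f g
  map_add' f f' := add_tmul f f' g
  map_smul' c f := smul_tmul c f g

theorem tmulRight_apply (f : AnFun a b) (g : AnFun ⊥ ⊤) : tmulRight g f = tmul f g := rfl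

theorem exists_coeff_expFun (a b : EReal) (r : ℤ) :
    ∃ φ : Symb a b →ₗ[ℂ] AnFun a b,
      ∀ f s, φ (tmul f (expFun s)) = if s = r then f else 0 := by
  have hli : LinearIndependent ℂ expFun :=
    linearIndependent_expC.comp (fun r : ℤ => (r : ℂ)) Int.cast_injective
  have hmem (s : ℤ) : expFun s ∈ Submodule.span ℂ (Set.range expFun) :=
    Submodule.subset_span (Set.mem_range_self s)
  obtain ⟨φ, hφ⟩ := LinearMap.exists_extend (Finsupp.lapply r ∘ₗ hli.repr)
  have hφ_exp (s : ℤ) : φ (expFun s) = if s = r then 1 else 0 := by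
    refine (LinearMap.congr_fun hφ ⟨expFun s, hmem s⟩).trans ?_
    rw [LinearMap.comp_apply, hli.repr_eq_single s ⟨expFun s, hmem s⟩ rfl, Finsupp.lapply_apply,
      Finsupp.single_apply]
  refine ⟨(TensorProduct.rid ℂ (AnFun a b)).toLinearMap ∘ₗ LinearMap.lTensor _ φ ∘ₗ
    (toTensor a b).toLinearMap, fun f s => ?_⟩
  rw [LinearMap.comp_apply, LinearMap.comp_apply, AlgEquiv.toLinearMap_apply, toTensor_tmul,
    LinearMap.lTensor_tmul, hφ_exp, LinearEquiv.coe_coe, TensorProduct.rid_tmul, ite_smul, one_smul,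
    zero_smul]

theorem tmul_one_injective : Function.Injective fun f : AnFun a b => tmul f 1 := by
  obtain ⟨φ, hφ⟩ := exists_coeff_expFun a b 0
  refine Function.LeftInverse.injective (g := φ) fun f => ?_
  simpa only [expFun_eq_expC, Int.cast_zero, expC_zero, if_true] using hφ f 0

end Symb

theorem dP_pow_tmul (n : ℕ) (f : AnFun a b) (g : AnFun ⊥ ⊤) :
    (dP a b ^ n) (Symb.tmul f g) = Symb.tmul ((AnFun.derivEnd a b ^ n) f) g := by
  have hcomm : dP a b ∘ₗ Symb.tmulRight g = Symb.tmulRight g ∘ₗ AnFun.derivEnd a b :=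
    LinearMap.ext fun f => dP_tmul f g
  exact LinearMap.congr_fun (Module.End.commute_pow_left_of_commute hcomm n) f

theorem dQ_tmul_expC (f : AnFun a b) (c : ℂ) :
    dQ a b (Symb.tmul f (expC c)) = (Complex.I * c) • Symb.tmul f (expC c) := by
  rw [dQ_tmul, deriv_expC, Symb.tmul_smul]

theorem mapCoeff_C {R : Type*} [CommRing R] [Algebra ℂ R] (D : R →ₗ[ℂ] R) (u : R) :
    mapCoeff D (PowerSeries.C u) = PowerSeries.C (D u) := by
  ext n
  rw [coeff_mapCoeff, PowerSeries.coeff_C, PowerSeries.coeff_C]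
  split_ifs
  · rfl
  · exact map_zero D

namespace Heis

/-- The coefficient of `εⁿ` in the normal ordered form of an element. -/
noncomputable def coeff (n : ℕ) : Heis a b →ₗ[ℂ] Symb a b where
  toFun u := PowerSeries.coeff n u.symb
  map_add' _ _ := map_add _ _ _
  map_smul' _ _ := rfl

theorem coeff_apply (n : ℕ) (u : Heis a b) : coeff n u = PowerSeries.coeff n u.symb := rfl

theorem ext_coeff {u v : Heis a b} (h : ∀ n, coeff n u = coeff n v) : u = v :=
  Heis.ext (PowerSeries.ext h)

theorem symb_mul (u v : Heis a b) :
    (u * v).symb = starMul Complex.I (dP a b) (dQ a b) u.symb v.symb := rfl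

theorem coeff_ofP (F : (AnFun a b)⟦X⟧) (n : ℕ) :
    coeff n (ofP F) = Symb.tmul (PowerSeries.coeff n F) 1 :=
  PowerSeries.coeff_map (Symb.ofP a b).toRingHom n F

theorem ofP_injective : Function.Injective (ofP : (AnFun a b)⟦X⟧ → Heis a b) := fun F G h => by
  ext1 n
  refine Symb.tmul_one_injective ?_
  simpa only [coeff_ofP] using congrArg (coeff n) h

theorem symb_ofP_mul (F : (AnFun a b)⟦X⟧) (u : Heis a b) :
    (ofP F * u).symb = (ofP F).symb * u.symb := by
  refine starMul_eq_mul_left _ _ _ _ _ ?_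
  ext n
  rw [coeff_mapCoeff, ← coeff_apply, coeff_ofP, dQ_tmul, Derivation.map_one_eq_zero,
    Symb.tmul_zero, map_zero]

theorem symb_mul_ofQ (u : Heis a b) (g : AnFun ⊥ ⊤) :
    (u * ofQ g).symb = u.symb * PowerSeries.C (Symb.tmul 1 g) := by
  refine starMul_eq_mul_right _ _ _ _ (ofQ g).symb ?_
  rw [ofQ, mapCoeff_C, dP_tmul, Derivation.map_one_eq_zero, Symb.zero_tmul, map_zero]

theorem coeff_ofP_mul_ofQ (F : (AnFun a b)⟦X⟧) (g : AnFun ⊥ ⊤) (n : ℕ) :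
    coeff n (ofP F * ofQ g) = Symb.tmul (PowerSeries.coeff n F) g := by
  rw [coeff_apply, symb_mul_ofQ, PowerSeries.coeff_mul_C, ← coeff_apply, coeff_ofP,
    Symb.tmul_mul_tmul, mul_one, one_mul]

/-- `F ↦ F(p, ε)` as an algebra homomorphism. -/
noncomputable def ofPHom (a b : EReal) : (AnFun a b)⟦X⟧ →ₐ[ℂ] Heis a b :=
  AlgHom.ofLinearMap
    { toFun := ofP
      map_add' := fun F G => Heis.ext (map_add (PowerSeries.map (Symb.ofP a b).toRingHom) F G)
      map_smul' := fun c F => ext_coeff fun n => by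
        rw [RingHom.id_apply, map_smul, coeff_ofP, coeff_ofP, PowerSeries.coeff_smul,
          Symb.smul_tmul] }
    (Heis.ext (map_one (PowerSeries.map (Symb.ofP a b).toRingHom)))
    (fun F G => Heis.ext <|
      (map_mul (PowerSeries.map (Symb.ofP a b).toRingHom) F G).trans (symb_ofP_mul F _).symm)

theorem ofPHom_apply (F : (AnFun a b)⟦X⟧) : ofPHom a b F = ofP F := rfl

theorem ofP_one : (ofP 1 : Heis a b) = 1 := map_one (ofPHom a b)

theorem ofP_mul (F G : (AnFun a b)⟦X⟧) : ofP (F * G) = ofP F * ofP G := map_mul (ofPHom a b) F G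

theorem ofP_X : ofP (PowerSeries.X : (AnFun a b)⟦X⟧) = eps a b := Heis.ext (PowerSeries.map_X _)

theorem ofQ_mul (g g' : AnFun ⊥ ⊤) : (ofQ (g * g') : Heis a b) = ofQ g * ofQ g' := by
  refine Heis.ext ?_
  rw [symb_mul_ofQ, ofQ, ofQ, ← map_mul, Symb.tmul_mul_tmul, mul_one]

theorem ofQ_one : (ofQ 1 : Heis a b) = 1 := Heis.ext (map_one PowerSeries.C)

theorem ofQ_expC_mul (c d : ℂ) :
    (ofQ (expC c) * ofQ (expC d) : Heis a b) = ofQ (expC (c + d)) := by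
  rw [expC_add, ofQ_mul]

theorem ofQ_expC_mul_neg (c : ℂ) : (ofQ (expC c) * ofQ (expC (-c)) : Heis a b) = 1 := by
  rw [ofQ_expC_mul, add_neg_cancel, expC_zero, ofQ_one]

theorem ofQ_expC_neg_mul (c : ℂ) : (ofQ (expC (-c)) * ofQ (expC c) : Heis a b) = 1 := by
  rw [ofQ_expC_mul, neg_add_cancel, expC_zero, ofQ_one]

theorem ofQ_expC_mul_ofP (c : ℂ) (F : (AnFun a b)⟦X⟧) :
    ofQ (expC c) * ofP F = ofP (epsShift (-c) F) * ofQ (expC c) := by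
  refine ext_coeff fun n => ?_
  rw [coeff_ofP_mul_ofQ, coeff_apply, symb_mul, starMul, PowerSeries.coeff_mk, epsShift,
    PowerSeries.coeff_mk, ← Symb.tmulRight_apply, map_sum]
  refine Finset.sum_congr rfl fun kl _ => ?_
  have hq : (dQ a b ^ kl.1) (Symb.tmul 1 (expC c)) =
      (Complex.I * c) ^ kl.1 • Symb.tmul 1 (expC c) :=
    pow_apply_of_apply_eq_smul (dQ_tmul_expC 1 c) kl.1
  rw [ofQ, mapCoeff_C, hq, PowerSeries.coeff_C_mul, coeff_mapCoeff, ← coeff_apply, coeff_ofP,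
    dP_pow_tmul, smul_mul_assoc, Symb.tmul_mul_tmul, one_mul, mul_one, smul_smul, map_smul,
    Symb.tmulRight_apply]
  congr 1
  rw [div_mul_eq_mul_div, ← mul_pow, ← mul_assoc, Complex.I_mul_I, neg_one_mul]

theorem ofP_mul_ofQ_expC (c : ℂ) (F : (AnFun a b)⟦X⟧) :
    ofP F * ofQ (expC c) = ofQ (expC c) * ofP (epsShift c F) := by
  rw [← mul_one (ofP (epsShift c F)), ← ofQ_expC_neg_mul c, ← mul_assoc (ofP _)]
  have h := ofQ_expC_mul_ofP (-c) F
  rw [neg_neg] at h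
  rw [← h, ← mul_assoc, ← mul_assoc, ofQ_expC_mul_neg, one_mul]

theorem ofP_epsShift (c : ℂ) (F : (AnFun a b)⟦X⟧) :
    ofP (epsShift c F) = ofQ (expC (-c)) * ofP F * ofQ (expC c) := by
  rw [mul_assoc, ofP_mul_ofQ_expC, ← mul_assoc, ofQ_expC_neg_mul, one_mul]

end Heis

theorem coeff_epsShift (c : ℂ) (F : (AnFun a b)⟦X⟧) (n : ℕ) :
    PowerSeries.coeff n (epsShift c F) = ∑ kl ∈ antidiagonal n,
      divPow ℂ (c • AnFun.derivEnd a b) kl.1 (PowerSeries.coeff kl.2 F) := by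
  simp only [epsShift, PowerSeries.coeff_mk, divPow_smul, LinearMap.smul_apply]

theorem epsShift_mul (c : ℂ) (F G : (AnFun a b)⟦X⟧) :
    epsShift c (F * G) = epsShift c F * epsShift c G := by
  refine Heis.ofP_injective ?_
  calc Heis.ofP (epsShift c (F * G))
      = Heis.ofQ (expC (-c)) * (Heis.ofP F * (Heis.ofP G * Heis.ofQ (expC c))) := by
        rw [Heis.ofP_epsShift, Heis.ofP_mul, mul_assoc, mul_assoc]
    _ = Heis.ofQ (expC (-c)) * (Heis.ofQ (expC c) * Heis.ofP (epsShift c F)) *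
          Heis.ofP (epsShift c G) := by
        rw [Heis.ofP_mul_ofQ_expC, ← mul_assoc (Heis.ofP F), Heis.ofP_mul_ofQ_expC]
        simp only [mul_assoc]
    _ = Heis.ofP (epsShift c F * epsShift c G) := by
        rw [← mul_assoc, Heis.ofQ_expC_neg_mul, one_mul, Heis.ofP_mul]

/-- The shift `F(z, ε) ↦ F(z + cε, ε)` as an algebra homomorphism. -/
noncomputable def epsShiftHom (c : ℂ) : (AnFun a b)⟦X⟧ →ₐ[ℂ] (AnFun a b)⟦X⟧ :=
  AlgHom.ofLinearMap
    { toFun := epsShift c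
      map_add' := fun F G => by ext1 n; simp [coeff_epsShift, Finset.sum_add_distrib]
      map_smul' := fun t F => by ext1 n; simp [coeff_epsShift, Finset.smul_sum] }
    (Heis.ofP_injective <| by
      rw [LinearMap.coe_mk, AddHom.coe_mk, Heis.ofP_epsShift, Heis.ofP_one, mul_one,
        Heis.ofQ_expC_neg_mul])
    (epsShift_mul c)

theorem epsShiftHom_apply (c : ℂ) (F : (AnFun a b)⟦X⟧) : epsShiftHom c F = epsShift c F := rfl

theorem epsShift_epsShift (c d : ℂ) (F : (AnFun a b)⟦X⟧) :
    epsShift c (epsShift d F) = epsShift (c + d) F := by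
  refine Heis.ofP_injective ?_
  rw [Heis.ofP_epsShift, Heis.ofP_epsShift, Heis.ofP_epsShift, neg_add, add_comm c d,
    ← Heis.ofQ_expC_mul, ← Heis.ofQ_expC_mul]
  simp only [mul_assoc]

theorem epsShift_zero (F : (AnFun a b)⟦X⟧) : epsShift 0 F = F := by
  refine Heis.ofP_injective ?_
  rw [Heis.ofP_epsShift, neg_zero, expC_zero, Heis.ofQ_one, one_mul, mul_one]

theorem constantCoeff_epsShift (c : ℂ) (F : (AnFun a b)⟦X⟧) :
    PowerSeries.constantCoeff (epsShift c F) = PowerSeries.constantCoeff F := by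
  rw [← PowerSeries.coeff_zero_eq_constantCoeff_apply, coeff_epsShift]
  simp [divPow_zero]

theorem coeff_epsShift_C (c : ℂ) (f : AnFun a b) (n : ℕ) :
    PowerSeries.coeff n (epsShift c (PowerSeries.C f)) =
      divPow ℂ (c • AnFun.derivEnd a b) n f := by
  rw [coeff_epsShift, Finset.sum_eq_single (n, 0)]
  · rw [PowerSeries.coeff_zero_C]
  · rintro ⟨k, l⟩ hkl hne
    have hl : l ≠ 0 := by
      rintro rfl
      exact hne (Prod.ext ((add_zero k).symm.trans (mem_antidiagonal.mp hkl)) rfl)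
    rw [PowerSeries.coeff_C, if_neg hl, map_zero]
  · exact fun h => absurd (mem_antidiagonal.mpr (add_zero n)) h

/-! ### Symmetrisation and polynomial differential operators -/

section Symmetrisation

theorem eq_zero_of_forall_sum_pow_smul_eq_zero {K M : Type*} [Field K] [Infinite K]
    [AddCommGroup M] [Module K M] {N : ℕ} {v : ℕ → M}
    (h : ∀ s : K, ∑ m ∈ Finset.range N, s ^ m • v m = 0) {m : ℕ} (hm : m < N) : v m = 0 := by
  refine (Module.forall_dual_apply_eq_zero_iff K (v m)).mp fun φ => ?_
  have hpoly : ∑ k ∈ Finset.range N, Polynomial.monomial k (φ (v k)) = 0 := by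
    refine Polynomial.funext fun s => ?_
    have hφ := congrArg φ (h s)
    rw [map_sum, map_zero] at hφ
    rw [Polynomial.eval_finsetSum, Polynomial.eval_zero, ← hφ]
    refine Finset.sum_congr rfl fun k _ => ?_
    rw [Polynomial.eval_monomial, map_smul, smul_eq_mul, mul_comm]
  have hcoeff := congrArg (fun p => Polynomial.coeff p m) hpoly
  simpa [Polynomial.finsetSum_coeff, Polynomial.coeff_monomial, hm] using hcoeff

theorem sum_pow_eq_sum_prod_ofFn {A ι : Type*} [Semiring A] [Fintype ι] (f : ι → A) (N : ℕ) :
    (∑ i, f i) ^ N = ∑ w : Fin N → ι, (List.ofFn fun j => f (w j)).prod := by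
  induction N with
  | zero => simp
  | succ N ih =>
    rw [pow_succ', ih, Finset.sum_mul_sum, ← Fintype.sum_prod_type',
      ← (Fin.consEquiv fun _ => ι).sum_comp]
    simp [Fin.consEquiv]

variable {A : Type*} [Ring A] [Algebra ℂ A]

theorem prod_ofFn_ite_smul (x y : A) (s : ℂ) {N : ℕ} (w : Fin N → Bool) :
    (List.ofFn fun j => if w j = true then s • x else y).prod =
      s ^ (Finset.univ.filter fun j => w j = true).card •
        (List.ofFn fun j => if w j = true then x else y).prod := by
  induction N with
  | zero => simp
  | succ N ih =>
    rw [List.ofFn_succ, List.prod_cons, ih, List.ofFn_succ, List.prod_cons,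
      Fin.card_filter_univ_succ]
    split_ifs
    · rw [smul_mul_smul_comm, ← pow_succ']
    · rw [mul_smul_comm]

/-- The sum of all distinct words with `m` letters `x` and `N - m` letters `y`. -/
noncomputable def wordSum (x y : A) (N m : ℕ) : A :=
  ∑ w : Fin N → Bool with (Finset.univ.filter fun j => w j = true).card = m,
    (List.ofFn fun j => if w j = true then x else y).prod

theorem symAverage_eq_smul_wordSum (x y : A) (m n : ℕ) :
    symAverage x y m n = (((m + n).choose m : ℕ) : ℂ)⁻¹ • wordSum x y (m + n) m := rfl

theorem smul_add_pow_eq_sum_wordSum (x y : A) (s : ℂ) (N : ℕ) :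
    (s • x + y) ^ N = ∑ m ∈ Finset.range (N + 1), s ^ m • wordSum x y N m := by
  have hmem (w : Fin N → Bool) :
      (Finset.univ.filter fun j => w j = true).card ∈ Finset.range (N + 1) :=
    Finset.mem_range_succ_iff.mpr ((Finset.card_le_univ _).trans_eq (Fintype.card_fin N))
  calc (s • x + y) ^ N = (∑ c : Bool, if c = true then s • x else y) ^ N := by simp
    _ = ∑ w : Fin N → Bool, s ^ (Finset.univ.filter fun j => w j = true).card •
          (List.ofFn fun j => if w j = true then x else y).prod := by
        rw [sum_pow_eq_sum_prod_ofFn]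
        exact Finset.sum_congr rfl fun w _ => prod_ofFn_ite_smul x y s w
    _ = ∑ m ∈ Finset.range (N + 1), s ^ m • wordSum x y N m := by
        rw [← Finset.sum_fiberwise_of_maps_to fun w _ => hmem w]
        refine Finset.sum_congr rfl fun m _ => ?_
        rw [wordSum, Finset.smul_sum]
        refine Finset.sum_congr rfl fun w hw => ?_
        rw [(Finset.mem_filter.mp hw).2]

/-- Compare the coefficients of the powers of `s`. -/
theorem map_pow_mul_pow_eq_symAverage {R : Type*} [CommRing R] [Algebra ℂ R] {W : R →ₗ[ℂ] A}
    {x y : R} {X Y : A} (hW : ∀ (s : ℂ) N, W ((s • x + y) ^ N) = (s • X + Y) ^ N) (m n : ℕ) :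
    W (x ^ m * y ^ n) = symAverage X Y m n := by
  have hchoose : (((m + n).choose m : ℕ) : ℂ) ≠ 0 := by
    exact_mod_cast (Nat.choose_pos (Nat.le_add_right m n)).ne'
  have hcoeff : W (((m + n).choose m : ℂ) • (x ^ m * y ^ (m + n - m))) -
      wordSum X Y (m + n) m = 0 := by
    refine eq_zero_of_forall_sum_pow_smul_eq_zero (K := ℂ)
      (v := fun k => W (((m + n).choose k : ℂ) • (x ^ k * y ^ (m + n - k))) -
        wordSum X Y (m + n) k) (N := m + n + 1) (fun s => ?_) (by omega)
    have hpow := hW s (m + n)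
    rw [smul_add_pow_eq_sum_wordSum X, add_pow, map_sum] at hpow
    simp only [smul_sub, Finset.sum_sub_distrib]
    rw [sub_eq_zero, ← hpow]
    refine Finset.sum_congr rfl fun k _ => ?_
    rw [← map_smul]
    congr 1
    rw [smul_pow, smul_mul_assoc, smul_mul_assoc, mul_comm _ (Nat.cast _), ← nsmul_eq_mul,
      Nat.cast_smul_eq_nsmul]
  rw [Nat.add_sub_cancel_left, map_smul, sub_eq_zero] at hcoeff
  rw [symAverage_eq_smul_wordSum, ← hcoeff, smul_smul, inv_mul_cancel₀ hchoose, one_smul]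

end Symmetrisation

section DifferentialOperators

variable {R : Type*} [CommRing R] [Algebra ℂ R]

theorem apply_pow_of_leibniz {D : R →ₗ[ℂ] R} (hD : ∀ u v, D (u * v) = D u * v + u * D v)
    (u : R) (n : ℕ) : D (u ^ n) = n • (u ^ (n - 1) * D u) := by
  let D' : Derivation ℂ R R := Derivation.mk' D fun u v => by
    rw [hD, smul_eq_mul, smul_eq_mul, mul_comm (D u), add_comm]
  exact D'.leibniz_pow u n

/-- The differential operator `∑ c_{jk} Pʲ Qᵏ`, as a function of the family of coefficients. -/
noncomputable def diffOp (P Q : Module.End ℂ R) : (ℕ × ℕ →₀ R) →ₗ[ℂ] Module.End ℂ R :=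
  Finsupp.lsum ℂ fun j =>
    LinearMap.mulRight ℂ (P ^ j.1 * Q ^ j.2) ∘ₗ (Algebra.lmul ℂ R).toLinearMap

theorem diffOp_apply (P Q : Module.End ℂ R) (c : ℕ × ℕ →₀ R) (u : R) :
    diffOp P Q c u = c.sum fun j r => r * (P ^ j.1) ((Q ^ j.2) u) := by
  rw [diffOp, Finsupp.lsum_apply, Finsupp.sum, Finsupp.sum, LinearMap.sum_apply]
  rfl

variable {P Q : Module.End ℂ R} {x y : R}

theorem pow_apply_pow_mul {D : Module.End ℂ R} (hD : ∀ u v, D (u * v) = D u * v + u * D v)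
    (hx : D x = 1) {z : R} (hz : D z = 0) (i m : ℕ) :
    (D ^ i) (x ^ m * z) = (m.descFactorial i : ℂ) • (x ^ (m - i) * z) := by
  induction i with
  | zero => simp
  | succ i ih =>
    rw [pow_succ', Module.End.mul_apply, ih, map_smul, hD, apply_pow_of_leibniz hD, hx, hz, mul_one,
      mul_zero, add_zero, ← Nat.cast_smul_eq_nsmul ℂ, smul_mul_assoc, smul_smul,
      Nat.descFactorial_succ, Nat.cast_mul, mul_comm ((m - i : ℕ) : ℂ), Nat.sub_sub]

theorem pow_apply_pow_apply_monomial (hP : ∀ u v, P (u * v) = P u * v + u * P v)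
    (hQ : ∀ u v, Q (u * v) = Q u * v + u * Q v) (hPx : P x = 1) (hPy : P y = 0) (hQx : Q x = 0)
    (hQy : Q y = 1) (i j m n : ℕ) :
    (P ^ i) ((Q ^ j) (x ^ m * y ^ n)) =
      ((m.descFactorial i : ℂ) * (n.descFactorial j : ℂ)) • (x ^ (m - i) * y ^ (n - j)) := by
  have hpow {D : Module.End ℂ R} (hD : ∀ u v, D (u * v) = D u * v + u * D v) {z : R}
      (hz : D z = 0) (k : ℕ) : D (z ^ k) = 0 := by
    rw [apply_pow_of_leibniz hD, hz, mul_zero, smul_zero]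
  rw [mul_comm (x ^ m), pow_apply_pow_mul hQ hQy (hpow hQ hQx m), mul_comm (y ^ (n - j)), map_smul,
    pow_apply_pow_mul hP hPx (hpow hP hPy _), smul_smul, mul_comm (n.descFactorial j : ℂ)]

theorem eq_zero_of_diffOp_monomial_eq_zero (hP : ∀ u v, P (u * v) = P u * v + u * P v)
    (hQ : ∀ u v, Q (u * v) = Q u * v + u * Q v) (hPx : P x = 1) (hPy : P y = 0) (hQx : Q x = 0)
    (hQy : Q y = 1) {c : ℕ × ℕ →₀ R} (h : ∀ m n, diffOp P Q c (x ^ m * y ^ n) = 0) : c = 0 := by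
  have hdeg (N m n : ℕ) (hmn : m + n = N) : c (m, n) = 0 := by
    induction N using Nat.strong_induction_on generalizing m n with
    | _ N ih =>
      have hsum := h m n
      rw [diffOp_apply, Finsupp.sum, Finset.sum_eq_single (m, n)] at hsum
      · rw [pow_apply_pow_apply_monomial hP hQ hPx hPy hQx hQy, Nat.sub_self, Nat.sub_self,
          pow_zero, pow_zero, mul_one, mul_smul_comm, mul_one, Nat.descFactorial_self,
          Nat.descFactorial_self] at hsum
        refine (smul_eq_zero.mp hsum).resolve_left ?_
        exact_mod_cast mul_ne_zero m.factorial_ne_zero n.factorial_ne_zero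
      · rintro ⟨i, j⟩ _ hne
        rw [pow_apply_pow_apply_monomial hP hQ hPx hPy hQx hQy]
        by_cases hij : i ≤ m ∧ j ≤ n
        · have hlt : i + j < N := by
            have hne' : ¬(i = m ∧ j = n) := fun hc => hne (Prod.ext hc.1 hc.2)
            omega
          rw [ih (i + j) hlt i j rfl, zero_mul]
        · have hzero : (m.descFactorial i : ℂ) * (n.descFactorial j : ℂ) = 0 := by
            rcases not_and_or.mp hij with hi | hj
            · rw [Nat.descFactorial_of_lt (not_le.mp hi), Nat.cast_zero, zero_mul]
            · rw [Nat.descFactorial_of_lt (not_le.mp hj), Nat.cast_zero, mul_zero]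
          rw [hzero, zero_smul, mul_zero]
      · intro hnotMem
        rw [Finsupp.notMem_support_iff.mp hnotMem, zero_mul]
  exact Finsupp.ext fun ⟨m, n⟩ => hdeg _ m n rfl

end DifferentialOperators

/-! ### Wick ordering -/

theorem apply_one_of_leibniz {R : Type*} [CommRing R] [Algebra ℂ R] {D : Module.End ℂ R}
    (hD : ∀ u v, D (u * v) = D u * v + u * D v) : D 1 = 0 := by
  simpa using apply_pow_of_leibniz hD 1 0

namespace Symb

/-- The coordinate function `p` of the commutative algebra. -/
noncomputable def p (a b : EReal) : Symb a b := tmul (AnFun.coord a b) 1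

/-- The coordinate function `q` of the commutative algebra. -/
noncomputable def q (a b : EReal) : Symb a b := tmul 1 (AnFun.coord ⊥ ⊤)

theorem p_pow_mul_q_pow (m n : ℕ) :
    p a b ^ m * q a b ^ n = tmul (AnFun.coord a b ^ m) (AnFun.coord ⊥ ⊤ ^ n) := by
  have htmul_pow (f : AnFun a b) (g : AnFun ⊥ ⊤) (k : ℕ) : tmul f g ^ k = tmul (f ^ k) (g ^ k) :=
    Algebra.TensorProduct.tmul_pow f g k
  rw [p, q, htmul_pow, htmul_pow, tmul_mul_tmul, one_pow, one_pow, mul_one, one_mul]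

theorem dP_p : dP a b (p a b) = 1 := by rw [p, dP_tmul, deriv_coord, one_def]

theorem dP_q : dP a b (q a b) = 0 := by rw [q, dP_tmul, Derivation.map_one_eq_zero, zero_tmul]

theorem dQ_p : dQ a b (p a b) = 0 := by rw [p, dQ_tmul, Derivation.map_one_eq_zero, tmul_zero]

theorem dQ_q : dQ a b (q a b) = 1 := by rw [q, dQ_tmul, deriv_coord, one_def]

end Symb

/-- The Wick ordering `exp((iε/2) ∂²/∂p∂q)`, in the normal ordered form of the values. -/
noncomputable def wick (a b : EReal) : Symb a b →ₗ[ℂ] Heis a b where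
  toFun u := ⟨expSeries ((Complex.I / 2) • (dP a b * dQ a b)) u⟩
  map_add' u v := Heis.ext (map_add _ u v)
  map_smul' c u := Heis.ext (map_smul _ c u)

theorem coeff_wick (u : Symb a b) (n : ℕ) :
    Heis.coeff n (wick a b u) = divPow ℂ ((Complex.I / 2) • (dP a b * dQ a b)) n u :=
  coeff_expSeries _ u n

theorem coeff_zero_wick (u : Symb a b) : Heis.coeff 0 (wick a b u) = u := by
  rw [coeff_wick, divPow_zero, Module.End.one_apply]

theorem wick_of_dP_dQ_eq_zero {u : Symb a b} (h : dP a b (dQ a b u) = 0) :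
    wick a b u = ⟨PowerSeries.C u⟩ :=
  Heis.ext <| expSeries_of_apply_eq_zero <| by
    rw [LinearMap.smul_apply, Module.End.mul_apply, h, smul_zero]

theorem wick_one : wick a b 1 = 1 := by
  rw [wick_of_dP_dQ_eq_zero (by rw [apply_one_of_leibniz dQ_mul, map_zero]), map_one]
  rfl

theorem wick_p : wick a b (Symb.p a b) = Heis.p a b := by
  rw [wick_of_dP_dQ_eq_zero (by rw [Symb.dQ_p, map_zero])]
  exact Heis.ext (PowerSeries.map_C (Symb.ofP a b).toRingHom (AnFun.coord a b)).symm

theorem wick_q : wick a b (Symb.q a b) = Heis.q a b :=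
  wick_of_dP_dQ_eq_zero (by rw [Symb.dQ_q, apply_one_of_leibniz dP_mul])

theorem biPow_zero (u v : Symb a b) : biPow 0 u v = u * v := by simp [biPow]

theorem biPow_one (u v : Symb a b) :
    biPow 1 u v = dQ a b u * dP a b v - dP a b u * dQ a b v := by
  simp [biPow, biP]

theorem veyCoeff_zero (u v : Symb a b) : veyCoeff 0 u v = u * v := by
  simp [veyCoeff, biPow_zero]

theorem veyCoeff_eq_mul' (k : ℕ) (u v : Symb a b) :
    veyCoeff k u v =
      LinearMap.mul' ℂ (Symb a b) (divPow ℂ ((Complex.I / 2) • biP a b) k (u ⊗ₜ v)) := by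
  rw [veyCoeff, biPow, divPow_smul, LinearMap.smul_apply, map_smul]

theorem veyCoeff_of_biP_eq_zero {u v : Symb a b} (h : biP a b (u ⊗ₜ v) = 0) {k : ℕ} (hk : k ≠ 0) :
    veyCoeff k u v = 0 := by
  have hzero : ((Complex.I / 2) • biP a b) (u ⊗ₜ v) = 0 := by
    rw [LinearMap.smul_apply, h, smul_zero]
  rw [veyCoeff_eq_mul', divPow_apply_of_apply_eq_zero hzero hk, map_zero]

/-- The series `∑ₖ εᵏ Ω_W(cₖ)`. -/
noncomputable def wickSeries (c : ℕ → Symb a b) : Heis a b :=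
  ⟨PowerSeries.mk fun n => ∑ kl ∈ antidiagonal n, Heis.coeff kl.2 (wick a b (c kl.1))⟩

theorem coeff_wickSeries (c : ℕ → Symb a b) (n : ℕ) :
    Heis.coeff n (wickSeries c) = ∑ kl ∈ antidiagonal n, Heis.coeff kl.2 (wick a b (c kl.1)) :=
  PowerSeries.coeff_mk n fun n => ∑ kl ∈ antidiagonal n, Heis.coeff kl.2 (wick a b (c kl.1))

theorem wick_mul_wick (u v : Symb a b) :
    wick a b u * wick a b v = wickSeries fun k => veyCoeff k u v := by
  refine Heis.ext_coeff fun n => ?_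
  rw [coeff_wickSeries]
  simp only [veyCoeff_eq_mul']
  exact coeff_starMul_expSeries_eq_sum Complex.I dP_mul dQ_mul (dP_dQ_comm a b) u v n

theorem wickSeries_injective :
    Function.Injective (wickSeries : (ℕ → Symb a b) → Heis a b) := by
  intro c c' h
  funext n
  induction n using Nat.strong_induction_on with
  | _ n ih =>
    have hn := congrArg (Heis.coeff n) h
    have hlower : ∑ k ∈ Finset.range n, Heis.coeff (n - k) (wick a b (c k)) =
        ∑ k ∈ Finset.range n, Heis.coeff (n - k) (wick a b (c' k)) :=
      Finset.sum_congr rfl fun k hk => by rw [ih k (Finset.mem_range.mp hk)]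
    rw [coeff_wickSeries, coeff_wickSeries, Finset.Nat.sum_antidiagonal_eq_sum_range_succ_mk,
      Finset.Nat.sum_antidiagonal_eq_sum_range_succ_mk, Finset.sum_range_succ,
      Finset.sum_range_succ, hlower] at hn
    simpa only [Nat.sub_self, coeff_zero_wick, add_right_inj] using hn

theorem wickSeries_of_forall_ne_zero {c : ℕ → Symb a b} (h : ∀ k, k ≠ 0 → c k = 0) :
    wickSeries c = wick a b (c 0) := by
  refine Heis.ext_coeff fun n => ?_
  rw [coeff_wickSeries, Finset.sum_eq_single (0, n)]
  · rintro ⟨k, l⟩ hkl hne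
    have hk : k ≠ 0 := by
      rintro rfl
      exact hne (Prod.ext rfl ((zero_add l).symm.trans (mem_antidiagonal.mp hkl)))
    rw [h k hk, map_zero, map_zero]
  · exact fun hn => absurd (mem_antidiagonal.mpr (zero_add n)) hn

theorem wick_mul_wick_of_biP_eq_zero {u v : Symb a b} (h : biP a b (u ⊗ₜ v) = 0) :
    wick a b u * wick a b v = wick a b (u * v) := by
  rw [wick_mul_wick, wickSeries_of_forall_ne_zero fun k hk => veyCoeff_of_biP_eq_zero h hk,
    veyCoeff_zero]

theorem biP_tmul_pow_eq_zero {u : Symb a b} {c d : ℂ} (hP : dP a b u = c • 1)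
    (hQ : dQ a b u = d • 1) (n : ℕ) : biP a b (u ⊗ₜ (u ^ n)) = 0 := by
  rw [biP, LinearMap.sub_apply, TensorProduct.map_tmul, TensorProduct.map_tmul,
    apply_pow_of_leibniz dP_mul, apply_pow_of_leibniz dQ_mul, hP, hQ, mul_smul_comm, mul_smul_comm,
    smul_comm n c, smul_comm n d, TensorProduct.smul_tmul_smul, TensorProduct.smul_tmul_smul,
    mul_comm c, sub_self]

theorem wick_pow {u : Symb a b} {c d : ℂ} (hP : dP a b u = c • 1) (hQ : dQ a b u = d • 1)
    (n : ℕ) : wick a b (u ^ n) = wick a b u ^ n := by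
  induction n with
  | zero => rw [pow_zero, pow_zero, wick_one]
  | succ n ih =>
    rw [pow_succ', pow_succ', ← ih, wick_mul_wick_of_biP_eq_zero (biP_tmul_pow_eq_zero hP hQ n)]

theorem wick_smul_p_add_q_pow (s : ℂ) (n : ℕ) :
    wick a b ((s • Symb.p a b + Symb.q a b) ^ n) = (s • Heis.p a b + Heis.q a b) ^ n := by
  rw [wick_pow (c := s) (d := 1), map_add, map_smul, wick_p, wick_q]
  · rw [map_add, map_smul, Symb.dP_p, Symb.dP_q, add_zero]
  · rw [map_add, map_smul, Symb.dQ_p, Symb.dQ_q, smul_zero, zero_add, one_smul]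

theorem wick_isWickOrdering (a b : EReal) : IsWickOrdering (wick a b) where
  monomial m n := by
    rw [← Symb.p_pow_mul_q_pow, map_pow_mul_pow_eq_symAverage wick_smul_p_add_q_pow]
  differential n := by
    refine ⟨{(n, n)}, fun _ => algebraMap ℂ _ ((Complex.I / 2) ^ n / (n.factorial : ℂ)),
      fun u => ?_⟩
    rw [← Heis.coeff_apply, coeff_wick, divPow_smul, (dP_dQ_comm a b).mul_pow,
      Finset.sum_singleton, ← Algebra.smul_def]
    rfl

theorem IsWickOrdering.exists_diffOp {Ω : Symb a b →ₗ[ℂ] Heis a b} (h : IsWickOrdering Ω)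
    (n : ℕ) : ∃ c, Heis.coeff n ∘ₗ Ω = diffOp (dP a b) (dQ a b) c := by
  obtain ⟨s, c, hc⟩ := h.differential n
  refine ⟨Finsupp.indicator s fun j _ => c j, LinearMap.ext fun u => ?_⟩
  rw [diffOp_apply, Finsupp.sum_indicator_index _ fun j _ => zero_mul _]
  exact hc u

theorem IsWickOrdering.unique {Ω Ω' : Symb a b →ₗ[ℂ] Heis a b} (h : IsWickOrdering Ω)
    (h' : IsWickOrdering Ω') : Ω = Ω' := by
  refine LinearMap.ext fun u => Heis.ext_coeff fun n => ?_
  obtain ⟨c, hc⟩ := h.exists_diffOp n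
  obtain ⟨c', hc'⟩ := h'.exists_diffOp n
  have hsub : c - c' = 0 := by
    refine eq_zero_of_diffOp_monomial_eq_zero dP_mul dQ_mul Symb.dP_p Symb.dP_q Symb.dQ_p Symb.dQ_q
      fun m k => ?_
    rw [map_sub, ← hc, ← hc', LinearMap.sub_apply, LinearMap.comp_apply, LinearMap.comp_apply,
      Symb.p_pow_mul_q_pow, h.monomial, h'.monomial, sub_self]
  have hcomp : Heis.coeff n ∘ₗ Ω = Heis.coeff n ∘ₗ Ω' := by rw [hc, hc', sub_eq_zero.mp hsub]
  exact LinearMap.congr_fun hcomp u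

/-! ### Expansions in powers of `ε` -/

theorem Heis.eps_pow_mul (N : ℕ) (u : Heis a b) :
    Heis.eps a b ^ N * u = ⟨PowerSeries.X ^ N * u.symb⟩ := by
  induction N with
  | zero => rw [pow_zero, one_mul, pow_zero, one_mul]
  | succ N ih => rw [pow_succ', mul_assoc, ih, Heis.eps_mul, ← mul_assoc, ← pow_succ']

theorem Heis.coeff_eps_pow_mul (N : ℕ) (u : Heis a b) (n : ℕ) :
    coeff n (Heis.eps a b ^ N * u) = if N ≤ n then coeff (n - N) u else 0 := by
  rw [Heis.eps_pow_mul, coeff_apply, PowerSeries.coeff_X_pow_mul']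
  rfl

theorem Heis.exists_eq_add_eps_pow_mul_iff {x y : Heis a b} {N : ℕ} :
    (∃ v, x = y + Heis.eps a b ^ N * v) ↔ ∀ n < N, coeff n x = coeff n y := by
  constructor
  · rintro ⟨v, rfl⟩ n hn
    rw [map_add, coeff_eps_pow_mul, if_neg hn.not_ge, add_zero]
  · intro h
    have hdvd : PowerSeries.X ^ N ∣ x.symb - y.symb :=
      PowerSeries.X_pow_dvd_iff.mpr fun n hn => by rw [map_sub, sub_eq_zero]; exact h n hn
    obtain ⟨w, hw⟩ := hdvd
    refine ⟨⟨w⟩, Heis.ext ?_⟩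
    rw [Heis.eps_pow_mul]
    exact sub_eq_iff_eq_add'.mp hw

theorem coeff_sum_eps_pow_mul_wick (c : ℕ → Symb a b) {n N : ℕ} (h : n < N) :
    Heis.coeff n (∑ k ∈ Finset.range N, Heis.eps a b ^ k * wick a b (c k)) =
      Heis.coeff n (wickSeries c) := by
  rw [map_sum, coeff_wickSeries, Finset.Nat.sum_antidiagonal_eq_sum_range_succ_mk,
    ← Finset.sum_subset (Finset.range_subset_range.mpr h)]
  · refine Finset.sum_congr rfl fun k hk => ?_
    rw [Heis.coeff_eps_pow_mul, if_pos (Finset.mem_range_succ_iff.mp hk)]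
  · intro k _ hk
    rw [Heis.coeff_eps_pow_mul, if_neg fun hkn => hk (Finset.mem_range_succ_iff.mpr hkn)]

theorem eq_wickSeries_iff {x : Heis a b} {c : ℕ → Symb a b} :
    x = wickSeries c ↔ ∀ N, ∃ v,
      x = ∑ k ∈ Finset.range N, Heis.eps a b ^ k * wick a b (c k) + Heis.eps a b ^ N * v := by
  simp only [Heis.exists_eq_add_eps_pow_mul_iff]
  constructor
  · rintro rfl N n hn
    exact (coeff_sum_eps_pow_mul_wick c hn).symm
  · exact fun h => Heis.ext_coeff fun n =>
      (h (n + 1) n n.lt_succ_self).trans (coeff_sum_eps_pow_mul_wick c n.lt_succ_self)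

/-! ### Positive square roots of formal series -/

theorem exists_mul_self_eq_one_add {R : Type*} [CommRing R] [Algebra ℚ R] {u : R⟦X⟧}
    (hu : PowerSeries.constantCoeff u = 0) :
    ∃ s : R⟦X⟧, s * s = 1 + u ∧ PowerSeries.constantCoeff s = 1 := by
  have hsubst := PowerSeries.HasSubst.of_constantCoeff_zero' hu
  set B : R⟦X⟧ := PowerSeries.binomialSeries R (1 / 2 : ℚ) with hB
  have hBB : B * B = 1 + PowerSeries.X := by
    rw [hB, ← PowerSeries.binomialSeries_add, add_halves, ← Nat.cast_one,
      PowerSeries.binomialSeries_nat, pow_one]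
  have hone : PowerSeries.subst u (1 : R⟦X⟧) = 1 := by
    rw [← PowerSeries.coe_substAlgHom hsubst, map_one]
  refine ⟨PowerSeries.subst u B, ?_, ?_⟩
  · rw [← PowerSeries.subst_mul hsubst, hBB, PowerSeries.subst_add hsubst,
      PowerSeries.subst_X hsubst, hone]
  · have hzero := PowerSeries.constantCoeff_subst_eq_zero hu (B - 1) (by
      rw [map_sub, map_one, hB, PowerSeries.binomialSeries_constantCoeff, sub_self])
    rw [PowerSeries.subst_sub hsubst, hone, map_sub, map_one] at hzero
    exact sub_eq_zero.mp hzero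

theorem exists_mul_self_eq {R : Type*} [CommRing R] [Algebra ℚ R] {F : R⟦X⟧} {s₀ : R}
    (hunit : IsUnit s₀) (hs₀ : s₀ * s₀ = PowerSeries.constantCoeff F) :
    ∃ s : R⟦X⟧, s * s = F ∧ PowerSeries.constantCoeff s = s₀ := by
  obtain ⟨t, ht⟩ := hunit.exists_right_inv
  obtain ⟨s, hs, hs_one⟩ := exists_mul_self_eq_one_add (u := PowerSeries.C (t * t) * F - 1) (by
    rw [map_sub, map_mul, PowerSeries.constantCoeff_C, ← hs₀, map_one]
    linear_combination (t * s₀ + 1) * ht)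
  have hC : PowerSeries.C s₀ * PowerSeries.C t = (1 : R⟦X⟧) := by rw [← map_mul, ht, map_one]
  refine ⟨PowerSeries.C s₀ * s, ?_, by
    rw [map_mul, hs_one, PowerSeries.constantCoeff_C, mul_one]⟩
  rw [map_mul] at hs
  linear_combination (PowerSeries.C s₀ * PowerSeries.C s₀) * hs +
    (PowerSeries.C s₀ * PowerSeries.C t + 1) * F * hC

/-- Functions with positive real values; the positivity required of the leading coefficient
of `ρ` and of its square root in `IsPosSqrt`. -/
def IsPosFun (f : AnFun a b) : Prop := ∀ z, ∃ y : ℝ, 0 < y ∧ f.1 z = y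

namespace IsPosFun

variable {f g : AnFun a b}

theorem add (hf : IsPosFun f) (hg : IsPosFun g) : IsPosFun (f + g) := fun z => by
  obtain ⟨y, hy, hfz⟩ := hf z
  obtain ⟨y', hy', hgz⟩ := hg z
  exact ⟨y + y', add_pos hy hy', (congrArg₂ (· + ·) hfz hgz).trans (Complex.ofReal_add y y').symm⟩

theorem isUnit (hf : IsPosFun f) : IsUnit f := by
  have hne : ∀ z, f.1 z ≠ 0 := fun z => by
    obtain ⟨y, hy, hfz⟩ := hf z
    rw [hfz]
    exact_mod_cast hy.ne'
  refine IsUnit.of_mul_eq_one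
    (AnFun.of (fun t => (extZero f.1 t)⁻¹) fun t ht => (f.2 t ht).inv ?_) ?_
  · rw [extZero_apply f.1 ⟨t, ht⟩]
    exact hne _
  · ext z
    change f.1 z * (extZero f.1 z)⁻¹ = 1
    rw [extZero_apply, mul_inv_cancel₀ (hne z)]

theorem exists_mul_self_eq (hf : IsPosFun f) : ∃ s : AnFun a b, IsPosFun s ∧ s * s = f := by
  have hre : ∀ z : realIoo a b, 0 < (extZero f.1 z).re ∧ f.1 z = (extZero f.1 z).re := by
    intro z
    obtain ⟨y, hy, hfz⟩ := hf z
    rw [extZero_apply, hfz, Complex.ofReal_re]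
    exact ⟨hy, rfl⟩
  -- `exp (log f / 2)` is visibly analytic, unlike `√f`.
  refine ⟨AnFun.of (fun t => ((Real.exp (Real.log (extZero f.1 t).re / 2) : ℝ) : ℂ)) fun t ht => ?_,
    fun z => ⟨_, Real.exp_pos _, rfl⟩, ?_⟩
  · have hf_re : AnalyticAt ℝ (fun t => (extZero f.1 t).re) t :=
      (Complex.reCLM.analyticAt _).comp (f.2 t ht)
    exact (Complex.ofRealCLM.analyticAt _).comp ((hf_re.log (hre ⟨t, ht⟩).1).div_const.rexp)
  · ext z
    change ((Real.exp (Real.log (extZero f.1 z).re / 2) : ℝ) : ℂ) *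
      ((Real.exp (Real.log (extZero f.1 z).re / 2) : ℝ) : ℂ) = f.1 z
    rw [(hre z).2, ← Complex.ofReal_mul, ← Real.exp_add, add_halves, Real.exp_log (hre z).1]

theorem isUnit_of_constantCoeff {F : (AnFun a b)⟦X⟧}
    (hF : IsPosFun (PowerSeries.constantCoeff F)) : IsUnit F :=
  PowerSeries.isUnit_iff_constantCoeff.mpr hF.isUnit

theorem exists_isPosSqrt {F : (AnFun a b)⟦X⟧} (hF : IsPosFun (PowerSeries.constantCoeff F)) :
    ∃ s, IsPosSqrt s F := by
  obtain ⟨s₀, hs₀, hs₀F⟩ := hF.exists_mul_self_eq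
  obtain ⟨s, hsF, rfl⟩ := _root_.exists_mul_self_eq hs₀.isUnit hs₀F
  exact ⟨s, hsF, hs₀⟩

end IsPosFun

namespace IsPosSqrt

variable {s t F : (AnFun a b)⟦X⟧}

theorem isUnit (h : IsPosSqrt s F) : IsUnit s := IsPosFun.isUnit_of_constantCoeff h.2

theorem unique (hs : IsPosSqrt s F) (ht : IsPosSqrt t F) : s = t := by
  have hadd : IsUnit (s + t) := by
    refine IsPosFun.isUnit_of_constantCoeff ?_
    rw [map_add]
    exact IsPosFun.add hs.2 ht.2
  have hmul : (s + t) * (s - t) = 0 := by linear_combination hs.1 - ht.1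
  exact sub_eq_zero.mp (hadd.mul_right_eq_zero.mp hmul)

theorem epsShift (hs : IsPosSqrt s F) (c : ℂ) : IsPosSqrt (epsShift c s) (epsShift c F) :=
  ⟨by rw [← epsShift_mul, hs.1], by rw [constantCoeff_epsShift]; exact hs.2⟩

end IsPosSqrt

theorem isPosFun_constantCoeff_epsTaylor {ρ : ℝ → ℝ → ℝ}
    (hρ : ∀ z ∈ realIoo a b, AnalyticAt ℝ (fun x : ℝ × ℝ => ρ x.1 x.2) (z, 0))
    (hpos : ∀ z ∈ realIoo a b, 0 < ρ z 0) :
    IsPosFun (PowerSeries.constantCoeff (epsTaylor ρ hρ)) := fun z => by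
  refine ⟨ρ z 0, hpos z z.2, ?_⟩
  rw [← PowerSeries.coeff_zero_eq_constantCoeff_apply, epsTaylor, PowerSeries.coeff_mk]
  change ((iteratedDeriv 0 (ρ z) 0 / ((0 : ℕ).factorial : ℝ) : ℝ) : ℂ) = _
  rw [iteratedDeriv_zero, Nat.factorial_zero, Nat.cast_one, div_one]

variable {ρ τ : (AnFun a b)⟦X⟧}

/-! ### Normal form in the noncommutative surface of rotation -/

namespace SurfAlg

/-- `F ↦ F(X₀, ε)` as a homomorphism. -/
noncomputable def fnHom (ρ : (AnFun a b)⟦X⟧) : (AnFun a b)⟦X⟧ →ₐ[ℂ] SurfAlg ρ :=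
  have map_const (c : ℂ) : fn ρ (algebraMap ℂ _ c) = algebraMap ℂ _ c :=
    (RingQuot.mkAlgHom_rel ℂ (SurfRel.const c)).trans (AlgHom.commutes _ c)
  { toFun := fn ρ
    map_add' := fun F G => (RingQuot.mkAlgHom_rel ℂ (SurfRel.add F G)).trans (map_add _ _ _)
    map_mul' := fun F G => (RingQuot.mkAlgHom_rel ℂ (SurfRel.mul F G)).trans (map_mul _ _ _)
    map_one' := by simpa only [map_one] using map_const 1
    map_zero' := by simpa only [map_zero] using map_const 0
    commutes' := map_const }

theorem fnHom_apply (F : (AnFun a b)⟦X⟧) : fnHom ρ F = fn ρ F := rfl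

theorem fnHom_mul_plus (F : (AnFun a b)⟦X⟧) :
    fnHom ρ F * plus ρ = plus ρ * fnHom ρ (epsShift 1 F) := by
  have h := RingQuot.mkAlgHom_rel ℂ (SurfRel.fn_plus (ρ := ρ) F)
  rwa [map_mul, map_mul] at h

theorem plus_mul_minus_add_minus_mul_plus : plus ρ * minus ρ + minus ρ * plus ρ =
    fnHom ρ (epsShift (-(1 / 2)) ρ) + fnHom ρ (epsShift (1 / 2) ρ) := by
  have h := RingQuot.mkAlgHom_rel ℂ (SurfRel.anticommutator (ρ := ρ))
  rwa [map_add, map_add, map_mul, map_mul] at h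

theorem plus_mul_minus_sub_minus_mul_plus : plus ρ * minus ρ - minus ρ * plus ρ =
    fnHom ρ (epsShift (-(1 / 2)) ρ) - fnHom ρ (epsShift (1 / 2) ρ) := by
  have h := RingQuot.mkAlgHom_rel ℂ (SurfRel.commutator (ρ := ρ))
  rwa [map_sub, map_sub, map_mul, map_mul] at h

theorem plus_mul_minus : plus ρ * minus ρ = fnHom ρ (epsShift (-(1 / 2)) ρ) := by
  refine smul_right_injective _ (two_ne_zero (α := ℂ)) ?_
  have h := congrArg₂ (· + ·) (plus_mul_minus_sub_minus_mul_plus (ρ := ρ))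
    plus_mul_minus_add_minus_mul_plus
  simpa only [sub_add_add_cancel, two_smul] using h

theorem minus_mul_plus : minus ρ * plus ρ = fnHom ρ (epsShift (1 / 2) ρ) := by
  have h := plus_mul_minus_add_minus_mul_plus (ρ := ρ)
  rw [plus_mul_minus] at h
  exact add_left_cancel h

theorem isUnit_plus (hρ : IsUnit ρ) : IsUnit (plus ρ) := by
  have hunit (c : ℂ) : IsUnit (fnHom ρ (epsShift c ρ)) := (hρ.map (epsShiftHom c)).map (fnHom ρ)
  obtain ⟨x, hx⟩ := (hunit (-(1 / 2))).exists_right_inv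
  obtain ⟨y, hy⟩ := (hunit (1 / 2)).exists_left_inv
  exact isUnit_iff_exists_and_exists.mpr ⟨⟨minus ρ * x, by rw [← mul_assoc, plus_mul_minus, hx]⟩,
    ⟨y * minus ρ, by rw [mul_assoc, minus_mul_plus, hy]⟩⟩

/-- A polar decomposition: `X₊ = E T` and `X₋ = T E⁻¹` with `T = √ρ(X₀ + ε/2, ε)`. -/
theorem exists_unit (hτ : IsUnit τ) (hτρ : τ * τ = epsShift (1 / 2) ρ) :
    ∃ E : (SurfAlg ρ)ˣ, plus ρ = E * fnHom ρ τ ∧ minus ρ = fnHom ρ τ * ↑E⁻¹ := by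
  have hρ : IsUnit ρ := by
    have h := (hτ.mul hτ).map (epsShiftHom (-(1 / 2)))
    rwa [epsShiftHom_apply, hτρ, epsShift_epsShift, neg_add_cancel, epsShift_zero] at h
  obtain ⟨u, hu⟩ := isUnit_plus hρ
  obtain ⟨T, hT⟩ := hτ.map (fnHom ρ)
  refine ⟨u * T⁻¹, ?_, ?_⟩
  · rw [← hT, ← Units.val_mul, inv_mul_cancel_right, hu]
  · rw [← hT, mul_inv_rev, inv_inv, Units.val_mul, ← mul_assoc, Units.eq_mul_inv_iff_mul_eq, hu,
      minus_mul_plus, ← hτρ, map_mul, hT]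

theorem zpow_mul_fnHom {E : (SurfAlg ρ)ˣ}
    (hE : ∀ F, (E : SurfAlg ρ) * fnHom ρ F = fnHom ρ (epsShift (-1) F) * E) (r : ℤ)
    (F : (AnFun a b)⟦X⟧) :
    (↑(E ^ r) : SurfAlg ρ) * fnHom ρ F = fnHom ρ (epsShift (-r) F) * ↑(E ^ r) := by
  have hE_inv (F) : (↑E⁻¹ : SurfAlg ρ) * fnHom ρ F = fnHom ρ (epsShift 1 F) * ↑E⁻¹ := by
    rw [Units.eq_mul_inv_iff_mul_eq, mul_assoc, Units.inv_mul_eq_iff_eq_mul, hE,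
      epsShift_epsShift, neg_add_cancel, epsShift_zero]
  induction r generalizing F with
  | zero => simp [epsShift_zero]
  | succ n ih =>
    rw [zpow_add_one, Units.val_mul, mul_assoc, hE, ← mul_assoc, ih, epsShift_epsShift, mul_assoc]
    push_cast
    ring_nf
  | pred n ih =>
    rw [zpow_sub_one, Units.val_mul, mul_assoc, hE_inv, ← mul_assoc, ih, epsShift_epsShift,
      mul_assoc]
    push_cast
    ring_nf

theorem mul_fnHom_of_plus_eq {E : (SurfAlg ρ)ˣ} (hτ : IsUnit τ) (hE : plus ρ = E * fnHom ρ τ)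
    (F : (AnFun a b)⟦X⟧) : (E : SurfAlg ρ) * fnHom ρ F = fnHom ρ (epsShift (-1) F) * E := by
  refine (hτ.map (fnHom ρ)).mul_right_cancel ?_
  rw [mul_assoc (fnHom ρ _), ← hE, fnHom_mul_plus, epsShift_epsShift, add_neg_cancel,
    epsShift_zero, hE, mul_assoc, mul_assoc, ← map_mul, ← map_mul, mul_comm F]

theorem subalgebra_eq_top {S : Subalgebra ℂ (SurfAlg ρ)} (hplus : plus ρ ∈ S)
    (hminus : minus ρ ∈ S) (hfn : ∀ F, fn ρ F ∈ S) : S = ⊤ := by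
  have hcomap : S.comap (RingQuot.mkAlgHom ℂ (SurfRel ρ)) = ⊤ := by
    rw [eq_top_iff, ← FreeAlgebra.adjoin_range_ι, Algebra.adjoin_le_iff]
    rintro _ ⟨g, rfl⟩
    cases g with
    | plus => exact hplus
    | minus => exact hminus
    | fn F => exact hfn F
  refine eq_top_iff.mpr fun x _ => ?_
  obtain ⟨y, rfl⟩ := RingQuot.mkAlgHom_surjective ℂ (SurfRel ρ) x
  exact (hcomap.ge trivial : y ∈ S.comap (RingQuot.mkAlgHom ℂ (SurfRel ρ)))

/-- The Laurent sum `∑ F_r(X₀, ε) Eʳ` of a finitely supported family `F`. -/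
noncomputable def laurent (E : (SurfAlg ρ)ˣ) : (ℤ →₀ (AnFun a b)⟦X⟧) →ₗ[ℂ] SurfAlg ρ :=
  Finsupp.lsum ℂ fun r =>
    LinearMap.mulRight ℂ (↑(E ^ r) : SurfAlg ρ) ∘ₗ (fnHom ρ).toLinearMap

theorem laurent_single (E : (SurfAlg ρ)ˣ) (r : ℤ) (F : (AnFun a b)⟦X⟧) :
    laurent E (Finsupp.single r F) = fnHom ρ F * ↑(E ^ r) := by
  rw [laurent, Finsupp.lsum_single]
  rfl

theorem laurent_mul_laurent_mem_range {E : (SurfAlg ρ)ˣ}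
    (hE : ∀ F, (E : SurfAlg ρ) * fnHom ρ F = fnHom ρ (epsShift (-1) F) * E)
    (G G' : ℤ →₀ (AnFun a b)⟦X⟧) : laurent E G * laurent E G' ∈ LinearMap.range (laurent E) := by
  induction G using Finsupp.induction_linear with
  | zero => rw [map_zero, zero_mul]; exact zero_mem _
  | add G₁ G₂ h₁ h₂ => rw [map_add, add_mul]; exact add_mem h₁ h₂
  | single r F =>
    induction G' using Finsupp.induction_linear with
    | zero => rw [map_zero, mul_zero]; exact zero_mem _
    | add G₁ G₂ h₁ h₂ => rw [map_add, mul_add]; exact add_mem h₁ h₂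
    | single s F' =>
      refine ⟨Finsupp.single (r + s) (F * epsShift (-r) F'), ?_⟩
      rw [laurent_single, laurent_single, laurent_single, zpow_add, Units.val_mul,
        map_mul, mul_assoc, ← mul_assoc (fnHom ρ (epsShift _ _)), ← zpow_mul_fnHom hE]
      simp only [mul_assoc]

theorem laurent_surjective {E : (SurfAlg ρ)ˣ} (hτ : IsUnit τ) (hplus : plus ρ = E * fnHom ρ τ)
    (hminus : minus ρ = fnHom ρ τ * ↑E⁻¹) : Function.Surjective (laurent E) := by
  have hfn (F) : fnHom ρ F ∈ LinearMap.range (laurent E) :=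
    ⟨Finsupp.single 0 F, by rw [laurent_single, zpow_zero, Units.val_one, mul_one]⟩
  have hE := mul_fnHom_of_plus_eq hτ hplus
  let S : Subalgebra ℂ (SurfAlg ρ) := (LinearMap.range (laurent E)).toSubalgebra
    (map_one (fnHom ρ) ▸ hfn 1)
    (by rintro _ _ ⟨G, rfl⟩ ⟨G', rfl⟩; exact laurent_mul_laurent_mem_range hE G G')
  have hS : S = ⊤ := by
    refine subalgebra_eq_top ⟨Finsupp.single 1 (epsShift (-1) τ), ?_⟩
      ⟨Finsupp.single (-1) τ, ?_⟩ hfn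
    · rw [laurent_single, zpow_one, hplus, hE]
    · rw [laurent_single, zpow_neg_one, hminus]
  exact fun x => (hS.ge trivial : x ∈ S)

end SurfAlg

/-! ### The Heisenberg coordinates -/

/-- The images of the generators under the Heisenberg coordinate homomorphism, where `τ` stands
for `√ρ(p + ε/2, ε)`. The image of `X₋` is `√ρ(p + ε/2, ε) e^{-iq} = e^{-iq} √ρ(p - ε/2, ε)`. -/
noncomputable def heisGen (τ : (AnFun a b)⟦X⟧) : SurfGen a b → Heis a b
  | .plus => Heis.ofQ (expC 1) * Heis.ofP τ
  | .minus => Heis.ofP τ * Heis.ofQ (expC (-1))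
  | .fn F => Heis.ofPHom a b F

theorem heisGen_minus_mul_plus (hτ : τ * τ = epsShift (1 / 2) ρ) :
    heisGen τ .minus * heisGen τ .plus = Heis.ofPHom a b (epsShift (1 / 2) ρ) := by
  change Heis.ofP τ * Heis.ofQ (expC (-1)) * (Heis.ofQ (expC 1) * Heis.ofP τ) = _
  rw [mul_assoc, ← mul_assoc (Heis.ofQ _), Heis.ofQ_expC_neg_mul, one_mul, ← hτ, map_mul]
  rfl

theorem heisGen_plus_mul_minus (hτ : τ * τ = epsShift (1 / 2) ρ) :
    heisGen τ .plus * heisGen τ .minus = Heis.ofPHom a b (epsShift (-(1 / 2)) ρ) := by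
  change Heis.ofQ (expC 1) * Heis.ofP τ * (Heis.ofP τ * Heis.ofQ (expC (-1))) = _
  rw [mul_assoc, ← mul_assoc (Heis.ofP τ), ← Heis.ofP_mul, hτ, ← mul_assoc,
    Heis.ofQ_expC_mul_ofP, epsShift_epsShift, mul_assoc, Heis.ofQ_expC_mul_neg, mul_one,
    Heis.ofPHom_apply]
  norm_num

theorem lift_heisGen_eq_of_surfRel (hτ : τ * τ = epsShift (1 / 2) ρ)
    ⦃x y : FreeAlgebra ℂ (SurfGen a b)⦄ (hxy : SurfRel ρ x y) :
    FreeAlgebra.lift ℂ (heisGen τ) x = FreeAlgebra.lift ℂ (heisGen τ) y := by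
  cases hxy with
  | add F G => simp only [map_add, FreeAlgebra.lift_ι_apply, heisGen]
  | mul F G => simp only [map_mul, FreeAlgebra.lift_ι_apply, heisGen]
  | const c => simp only [FreeAlgebra.lift_ι_apply, heisGen, AlgHom.commutes]
  | fn_plus F =>
    simp only [map_mul, FreeAlgebra.lift_ι_apply, heisGen, Heis.ofPHom_apply]
    rw [← mul_assoc, Heis.ofP_mul_ofQ_expC, mul_assoc, mul_assoc, ← Heis.ofP_mul, ← Heis.ofP_mul,
      mul_comm]
  | fn_minus F =>
    simp only [map_mul, FreeAlgebra.lift_ι_apply, heisGen, Heis.ofPHom_apply]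
    rw [mul_assoc, ← Heis.ofP_mul_ofQ_expC, ← mul_assoc, ← mul_assoc, ← Heis.ofP_mul,
      ← Heis.ofP_mul, mul_comm]
  | commutator =>
    rw [map_sub, map_sub, map_mul, map_mul]
    simp only [FreeAlgebra.lift_ι_apply]
    rw [heisGen_plus_mul_minus hτ, heisGen_minus_mul_plus hτ, heisGen, heisGen]
  | anticommutator =>
    rw [map_add, map_add, map_mul, map_mul]
    simp only [FreeAlgebra.lift_ι_apply]
    rw [heisGen_plus_mul_minus hτ, heisGen_minus_mul_plus hτ, heisGen, heisGen]

/-- The Heisenberg coordinate homomorphism attached to a square root `τ` of `ρ(z + ε/2, ε)`. -/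
noncomputable def heisCoord (hτ : τ * τ = epsShift (1 / 2) ρ) : SurfAlg ρ →ₐ[ℂ] Heis a b :=
  RingQuot.liftAlgHom ℂ ⟨FreeAlgebra.lift ℂ (heisGen τ), lift_heisGen_eq_of_surfRel hτ⟩

theorem heisCoord_ι (hτ : τ * τ = epsShift (1 / 2) ρ) (g : SurfGen a b) :
    heisCoord hτ (RingQuot.mkAlgHom ℂ (SurfRel ρ) (FreeAlgebra.ι ℂ g)) = heisGen τ g := by
  rw [heisCoord, RingQuot.liftAlgHom_mkAlgHom_apply, FreeAlgebra.lift_ι_apply]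

theorem isHeisenbergCoord_heisCoord (hτ : IsPosSqrt τ (epsShift (1 / 2) ρ)) :
    IsHeisenbergCoord (heisCoord hτ.1) where
  map_eps := (heisCoord_ι hτ.1 _).trans Heis.ofP_X
  map_fn _ := heisCoord_ι hτ.1 _
  map_plus := ⟨τ, hτ, by
    rw [expFun_eq_expC, Int.cast_one]
    exact heisCoord_ι hτ.1 _⟩
  map_minus := by
    refine ⟨epsShift (-1) τ, ?_, ?_⟩
    · have h := hτ.epsShift (-1)
      rwa [epsShift_epsShift, show (-1 : ℂ) + 1 / 2 = -(1 / 2) by norm_num] at h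
    · rw [expFun_eq_expC, Int.cast_neg, Int.cast_one, ← Heis.ofP_mul_ofQ_expC]
      exact heisCoord_ι hτ.1 _

theorem map_zpow_eq_ofQ_expFun {Ψ : SurfAlg ρ →ₐ[ℂ] Heis a b} {E : (SurfAlg ρ)ˣ}
    (hE : Ψ E = Heis.ofQ (expC 1)) (r : ℤ) :
    Ψ ↑(E ^ r) = Heis.ofQ (expFun r) := by
  let zpowE : Multiplicative ℤ →* Heis a b :=
    (Ψ : SurfAlg ρ →* Heis a b).comp ((Units.coeHom _).comp (zpowersHom _ E))
  let expQ : Multiplicative ℤ →* Heis a b :=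
    { toFun := fun r => Heis.ofQ (expC (r.toAdd : ℂ))
      map_one' := by rw [toAdd_one, Int.cast_zero, expC_zero, Heis.ofQ_one]
      map_mul' := fun r s => by rw [toAdd_mul, Int.cast_add, Heis.ofQ_expC_mul] }
  have heq : zpowE = expQ := MonoidHom.ext_mint (by simpa [zpowE, expQ] using hE)
  rw [expFun_eq_expC]
  exact DFunLike.congr_fun heq (Multiplicative.ofAdd r)

namespace IsHeisenbergCoord

theorem unique {Ψ Ψ' : SurfAlg ρ →ₐ[ℂ] Heis a b} (hΨ : IsHeisenbergCoord Ψ)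
    (hΨ' : IsHeisenbergCoord Ψ') : Ψ = Ψ' := by
  refine RingQuot.ringQuot_ext' ℂ _ _ (FreeAlgebra.hom_ext (funext fun g => ?_))
  cases g with
  | plus =>
    obtain ⟨s, hs, hΨs⟩ := hΨ.map_plus
    obtain ⟨s', hs', hΨs'⟩ := hΨ'.map_plus
    exact hΨs.trans (hs.unique hs' ▸ hΨs'.symm)
  | minus =>
    obtain ⟨s, hs, hΨs⟩ := hΨ.map_minus
    obtain ⟨s', hs', hΨs'⟩ := hΨ'.map_minus
    exact hΨs.trans (hs.unique hs' ▸ hΨs'.symm)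
  | fn F => exact (hΨ.map_fn F).trans (hΨ'.map_fn F).symm

theorem exists_laurent {Ψ : SurfAlg ρ →ₐ[ℂ] Heis a b} (hΨ : IsHeisenbergCoord Ψ) :
    ∃ Λ : (ℤ →₀ (AnFun a b)⟦X⟧) →ₗ[ℂ] SurfAlg ρ, Function.Surjective Λ ∧
      ∀ r F, Ψ (Λ (Finsupp.single r F)) = Heis.ofP F * Heis.ofQ (expFun r) := by
  obtain ⟨τ, hτ, hΨτ⟩ := hΨ.map_plus
  obtain ⟨E, hplus, hminus⟩ := SurfAlg.exists_unit hτ.isUnit hτ.1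
  have hE : Ψ E = Heis.ofQ (expC 1) := by
    refine (hτ.isUnit.map (Heis.ofPHom a b)).mul_right_cancel ?_
    rw [Heis.ofPHom_apply, ← hΨ.map_fn, ← SurfAlg.fnHom_apply, ← map_mul, ← hplus, hΨτ,
      SurfAlg.fnHom_apply, hΨ.map_fn, expFun_eq_expC, Int.cast_one]
  refine ⟨SurfAlg.laurent E, SurfAlg.laurent_surjective hτ.isUnit hplus hminus, fun r F => ?_⟩
  rw [SurfAlg.laurent_single, map_mul, map_zpow_eq_ofQ_expFun hE, SurfAlg.fnHom_apply, hΨ.map_fn]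

end IsHeisenbergCoord

/-! ### Trigonometric symbols -/

/-- The trigonometric symbols: the finite sums of functions `f(p) e^{irq}` with `r ∈ ℤ`. They form
the image of the surface at `ε = 0` under the Heisenberg coordinates. -/
noncomputable def trigSymb (a b : EReal) : Submodule ℂ (Symb a b) :=
  Submodule.span ℂ {u | ∃ f r, u = Symb.tmul f (expFun r)}

theorem tmul_expFun_mem (f : AnFun a b) (r : ℤ) : Symb.tmul f (expFun r) ∈ trigSymb a b :=
  Submodule.subset_span ⟨f, r, rfl⟩

theorem trigSymb_le {V : Submodule ℂ (Symb a b)} (h : ∀ f r, Symb.tmul f (expFun r) ∈ V) :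
    trigSymb a b ≤ V :=
  Submodule.span_le.mpr fun _ ⟨f, r, hu⟩ => hu ▸ h f r

theorem dP_mem_trigSymb {u : Symb a b} (hu : u ∈ trigSymb a b) : dP a b u ∈ trigSymb a b :=
  trigSymb_le (V := (trigSymb a b).comap (dP a b)) (fun _ r => tmul_expFun_mem _ r) hu

theorem dQ_mem_trigSymb {u : Symb a b} (hu : u ∈ trigSymb a b) : dQ a b u ∈ trigSymb a b :=
  trigSymb_le (V := (trigSymb a b).comap (dQ a b)) (fun f r => by
    rw [Submodule.mem_comap, expFun_eq_expC, dQ_tmul_expC]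
    exact Submodule.smul_mem _ _ (tmul_expFun_mem f r)) hu

theorem mul_mem_trigSymb {u v : Symb a b} (hu : u ∈ trigSymb a b) (hv : v ∈ trigSymb a b) :
    u * v ∈ trigSymb a b := by
  refine trigSymb_le (V := (trigSymb a b).comap (LinearMap.mulRight ℂ v)) (fun f r => ?_) hu
  refine trigSymb_le (V := (trigSymb a b).comap (LinearMap.mulLeft ℂ (Symb.tmul f (expFun r))))
    (fun g s => ?_) hv
  rw [Submodule.mem_comap, LinearMap.mulLeft_apply, Symb.tmul_mul_tmul, expFun_eq_expC,
    expFun_eq_expC, ← expC_add, ← Int.cast_add]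
  exact tmul_expFun_mem _ _

theorem veyCoeff_mem_trigSymb {u v : Symb a b} (hu : u ∈ trigSymb a b) (hv : v ∈ trigSymb a b)
    (k : ℕ) : veyCoeff k u v ∈ trigSymb a b := by
  let T := Submodule.map₂ (TensorProduct.mk ℂ (Symb a b) (Symb a b)) (trigSymb a b) (trigSymb a b)
  have hbiP : T ≤ T.comap (biP a b) := Submodule.map₂_le.mpr fun x hx y hy =>
    sub_mem (Submodule.apply_mem_map₂ _ (dQ_mem_trigSymb hx) (dP_mem_trigSymb hy))
      (Submodule.apply_mem_map₂ _ (dP_mem_trigSymb hx) (dQ_mem_trigSymb hy))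
  have hmul : T ≤ (trigSymb a b).comap (LinearMap.mul' ℂ (Symb a b)) :=
    Submodule.map₂_le.mpr fun x hx y hy => mul_mem_trigSymb hx hy
  have hpow : (biP a b ^ k) (u ⊗ₜ v) ∈ T :=
    Module.End.pow_apply_mem_of_forall_mem _ hbiP _ (Submodule.apply_mem_map₂ _ hu hv)
  exact Submodule.smul_mem _ _ (hmul hpow)

theorem wick_tmul_expFun (f : AnFun a b) (r : ℤ) :
    wick a b (Symb.tmul f (expFun r)) =
      Heis.ofP (epsShift (-(r : ℂ) / 2) (PowerSeries.C f)) * Heis.ofQ (expFun r) := by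
  refine Heis.ext_coeff fun n => ?_
  rw [coeff_wick, Heis.coeff_ofP_mul_ofQ, coeff_epsShift_C]
  refine divPow_apply_comm (f := Symb.tmulRight (expFun r)) (fun g => ?_) n f
  rw [Symb.tmulRight_apply, Symb.tmulRight_apply, LinearMap.smul_apply, Module.End.mul_apply,
    expFun_eq_expC, dQ_tmul_expC, map_smul, dP_tmul, smul_smul, LinearMap.smul_apply,
    Symb.smul_tmul]
  congr 1
  linear_combination (r : ℂ) / 2 * Complex.I_mul_I

theorem wick_tmul_expFun_eq_ofQ_mul (f : AnFun a b) (r : ℤ) :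
    wick a b (Symb.tmul f (expFun r)) =
      Heis.ofQ (expFun r) * Heis.ofP (epsShift ((r : ℂ) / 2) (PowerSeries.C f)) := by
  rw [wick_tmul_expFun, expFun_eq_expC, Heis.ofP_mul_ofQ_expC, epsShift_epsShift]
  congr 3
  ring

/-! ### The surface in Heisenberg coordinates -/

theorem SurfAlg.toClassical_surjective (ρ : (AnFun a b)⟦X⟧) :
    Function.Surjective (SurfAlg.toClassical ρ) := RingQuot.mkAlgHom_surjective ℂ _

theorem SurfAlg.toClassical_eps (ρ : (AnFun a b)⟦X⟧) :
    SurfAlg.toClassical ρ (SurfAlg.eps ρ) = 0 :=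
  (RingQuot.mkAlgHom_rel ℂ (s := fun x y : SurfAlg ρ => x = SurfAlg.eps ρ ∧ y = 0)
    ⟨rfl, rfl⟩).trans (map_zero _)

theorem Heis.coeff_zero_mul (u v : Heis a b) : coeff 0 (u * v) = coeff 0 u * coeff 0 v :=
  map_mul (Heis.classical a b) u v

theorem Heis.coeff_one_mul (u v : Heis a b) :
    coeff 1 (u * v) = coeff 0 u * coeff 1 v + coeff 1 u * coeff 0 v +
      Complex.I • (dQ a b (coeff 0 u) * dP a b (coeff 0 v)) := by
  have h : (antidiagonal 1 : Finset (ℕ × ℕ)) = {(0, 1), (1, 0)} := rfl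
  simp only [coeff_apply, symb_mul, starMul, PowerSeries.coeff_mk, h]
  rw [Finset.sum_pair (by simp), PowerSeries.coeff_mul, PowerSeries.coeff_mul, h,
    Finset.sum_pair (by simp)]
  simp [coeff_mapCoeff]

section Coordinates

variable {Ψ : SurfAlg ρ →ₐ[ℂ] Heis a b} {Λ : (ℤ →₀ (AnFun a b)⟦X⟧) →ₗ[ℂ] SurfAlg ρ}

theorem coeff_laurent
    (hΛ : ∀ r F, Ψ (Λ (Finsupp.single r F)) = Heis.ofP F * Heis.ofQ (expFun r))
    (G : ℤ →₀ (AnFun a b)⟦X⟧) (n : ℕ) :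
    Heis.coeff n (Ψ (Λ G)) = G.sum fun r F => Symb.tmul (PowerSeries.coeff n F) (expFun r) := by
  induction G using Finsupp.induction_linear with
  | zero => simp only [map_zero, Finsupp.sum_zero_index]
  | add G G' h h' =>
    rw [map_add, map_add, map_add, h, h', Finsupp.sum_add_index']
    · intro r
      rw [map_zero, Symb.zero_tmul]
    · intro r F F'
      rw [map_add, Symb.add_tmul]
  | single r F =>
    rw [hΛ, Finsupp.sum_single_index, Heis.coeff_ofP_mul_ofQ]
    rw [map_zero, Symb.zero_tmul]

theorem coeff_eq_zero_of_coeff_laurent_eq_zero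
    (hΛ : ∀ r F, Ψ (Λ (Finsupp.single r F)) = Heis.ofP F * Heis.ofQ (expFun r))
    {G : ℤ →₀ (AnFun a b)⟦X⟧} {n : ℕ} (h : Heis.coeff n (Ψ (Λ G)) = 0) (r : ℤ) :
    PowerSeries.coeff n (G r) = 0 := by
  obtain ⟨φ, hφ⟩ := Symb.exists_coeff_expFun a b r
  have hr := congrArg φ h
  rw [coeff_laurent hΛ, map_zero, map_finsuppSum] at hr
  simp only [hφ] at hr
  rw [Finsupp.sum_ite_eq'] at hr
  split_ifs at hr with hmem
  · exact hr
  · rw [Finsupp.notMem_support_iff.mp hmem, map_zero]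

namespace IsHeisenbergCoord

theorem injective (hΨ : IsHeisenbergCoord Ψ) : Function.Injective Ψ := by
  obtain ⟨Λ, hsurj, hΛ⟩ := hΨ.exists_laurent
  rw [injective_iff_map_eq_zero]
  intro x hx
  obtain ⟨G, rfl⟩ := hsurj x
  have hG : G = 0 := Finsupp.ext fun r => PowerSeries.ext fun n =>
    coeff_eq_zero_of_coeff_laurent_eq_zero hΛ (by rw [hx, map_zero]) r
  rw [hG, map_zero]

theorem exists_eps_pow_mul (hΨ : IsHeisenbergCoord Ψ) {N : ℕ} {x : SurfAlg ρ}
    (hx : ∀ n < N, Heis.coeff n (Ψ x) = 0) : ∃ y, x = SurfAlg.eps ρ ^ N * y := by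
  obtain ⟨Λ, hsurj, hΛ⟩ := hΨ.exists_laurent
  obtain ⟨G, rfl⟩ := hsurj x
  let shift (F : (AnFun a b)⟦X⟧) : (AnFun a b)⟦X⟧ :=
    PowerSeries.mk fun n => PowerSeries.coeff (n + N) F
  have hshift : shift 0 = 0 := PowerSeries.ext fun n => by
    simp only [shift, PowerSeries.coeff_mk, map_zero]
  refine ⟨Λ (G.mapRange shift hshift), hΨ.injective (Heis.ext_coeff fun n => ?_)⟩
  rw [map_mul, map_pow, hΨ.map_eps, Heis.coeff_eps_pow_mul]
  split_ifs with hn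
  · rw [coeff_laurent hΛ, coeff_laurent hΛ, Finsupp.sum_mapRange_index]
    · simp only [shift, PowerSeries.coeff_mk, Nat.sub_add_cancel hn]
    · intro r
      rw [map_zero, Symb.zero_tmul]
  · exact hx n (not_le.mp hn)

theorem exists_eq_add_eps_pow_mul_iff (hΨ : IsHeisenbergCoord Ψ) {x y : SurfAlg ρ} {N : ℕ} :
    (∃ z, x = y + SurfAlg.eps ρ ^ N * z) ↔
      ∃ v, Ψ x = Ψ y + Heis.eps a b ^ N * v := by
  constructor
  · rintro ⟨z, rfl⟩
    exact ⟨Ψ z, by rw [map_add, map_mul, map_pow, hΨ.map_eps]⟩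
  · intro h
    obtain ⟨z, hz⟩ := hΨ.exists_eps_pow_mul (N := N) (x := x - y) fun n hn => by
      rw [map_sub, map_sub, Heis.exists_eq_add_eps_pow_mul_iff.mp h n hn, sub_self]
    exact ⟨z, sub_eq_iff_eq_add'.mp hz⟩

theorem classical_toClassical_eq_coeff (hΨ : IsHeisenbergCoord Ψ) (x : SurfAlg ρ) :
    hΨ.classical (SurfAlg.toClassical ρ x) = Heis.coeff 0 (Ψ x) :=
  hΨ.classical_toClassical x

theorem classical_injective (hΨ : IsHeisenbergCoord Ψ) : Function.Injective hΨ.classical := by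
  rw [injective_iff_map_eq_zero]
  intro u hu
  obtain ⟨x, rfl⟩ := SurfAlg.toClassical_surjective ρ u
  rw [hΨ.classical_toClassical_eq_coeff] at hu
  obtain ⟨y, rfl⟩ := hΨ.exists_eps_pow_mul (N := 1) (x := x) fun n hn => by
    rwa [Nat.lt_one_iff.mp hn]
  rw [pow_one, map_mul, SurfAlg.toClassical_eps, zero_mul]

theorem classical_mem_trigSymb (hΨ : IsHeisenbergCoord Ψ) (u : SurfAlg.Classical ρ) :
    hΨ.classical u ∈ trigSymb a b := by
  obtain ⟨Λ, hsurj, hΛ⟩ := hΨ.exists_laurent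
  obtain ⟨x, rfl⟩ := SurfAlg.toClassical_surjective ρ u
  obtain ⟨G, rfl⟩ := hsurj x
  rw [hΨ.classical_toClassical_eq_coeff, coeff_laurent hΛ]
  exact Submodule.sum_mem _ fun r _ => tmul_expFun_mem _ r

theorem exists_eq_wick (hΨ : IsHeisenbergCoord Ψ) {w : Symb a b} (hw : w ∈ trigSymb a b) :
    ∃ x, Ψ x = wick a b w := by
  obtain ⟨Λ, -, hΛ⟩ := hΨ.exists_laurent
  refine trigSymb_le (V := (LinearMap.range Ψ.toLinearMap).comap (wick a b)) (fun f r =>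
    ⟨Λ (Finsupp.single r (epsShift (-(r : ℂ) / 2) (PowerSeries.C f))), ?_⟩) hw
  rw [AlgHom.toLinearMap_apply, hΛ, wick_tmul_expFun]

theorem exists_classical_eq (hΨ : IsHeisenbergCoord Ψ) {w : Symb a b} (hw : w ∈ trigSymb a b) :
    ∃ u, hΨ.classical u = w := by
  obtain ⟨x, hx⟩ := hΨ.exists_eq_wick hw
  exact ⟨SurfAlg.toClassical ρ x, by rw [hΨ.classical_toClassical_eq_coeff, hx, coeff_zero_wick]⟩

/-! ### The Poisson bracket -/

theorem exists_commutator_eq (hΨ : IsHeisenbergCoord Ψ) (x y : SurfAlg ρ) :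
    ∃ w, x * y - y * x = Complex.I • (SurfAlg.eps ρ * w) := by
  obtain ⟨w, hw⟩ := hΨ.exists_eps_pow_mul (N := 1) (x := x * y - y * x) fun n hn => by
    rw [Nat.lt_one_iff.mp hn, map_sub, map_sub, map_mul Ψ x, map_mul Ψ y, Heis.coeff_zero_mul,
      Heis.coeff_zero_mul, mul_comm, sub_self]
  refine ⟨(-Complex.I) • w, ?_⟩
  rw [hw, pow_one, mul_smul_comm, smul_smul, mul_neg, Complex.I_mul_I, neg_neg, one_smul]

theorem classical_commutator (hΨ : IsHeisenbergCoord Ψ) {x y w : SurfAlg ρ}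
    (hw : x * y - y * x = Complex.I • (SurfAlg.eps ρ * w)) :
    hΨ.classical (SurfAlg.toClassical ρ w) =
      biPow 1 (hΨ.classical (SurfAlg.toClassical ρ x))
        (hΨ.classical (SurfAlg.toClassical ρ y)) := by
  have hcoeff := congrArg (Heis.coeff 1 ∘ Ψ) hw
  have heps : Heis.coeff 1 (Heis.eps a b * Ψ w) = Heis.coeff 0 (Ψ w) := by
    rw [← pow_one (Heis.eps a b), Heis.coeff_eps_pow_mul, if_pos le_rfl]
  simp only [Function.comp_apply, map_sub, map_mul, map_smul, hΨ.map_eps, Heis.coeff_one_mul,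
    heps] at hcoeff
  simp only [biPow_one, hΨ.classical_toClassical_eq_coeff]
  refine smul_right_injective _ Complex.I_ne_zero (hcoeff.symm.trans ?_)
  change _ = Complex.I • _
  rw [smul_sub, mul_comm (dP a b _)]
  ring

end IsHeisenbergCoord

/-! ### The central ordering and its star product -/

theorem isCentralOrdering_iff (hΨ : IsHeisenbergCoord Ψ)
    (Ω : SurfAlg.Classical ρ →ₗ[ℂ] SurfAlg ρ) :
    IsCentralOrdering hΨ Ω ↔ ∀ u, Ψ (Ω u) = wick a b (hΨ.classical u) := by
  refine ⟨fun hΩ u => ?_, fun hΩ u r f hu => by rw [hΩ, hu, wick_tmul_expFun_eq_ofQ_mul]⟩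
  have htrig : trigSymb a b ≤ (LinearMap.eqLocus (Ψ.toLinearMap ∘ₗ Ω)
      (wick a b ∘ₗ hΨ.classical.toLinearMap)).map hΨ.classical.toLinearMap := by
    refine trigSymb_le fun f r => ?_
    obtain ⟨v, hv⟩ := hΨ.exists_classical_eq (tmul_expFun_mem f r)
    refine ⟨v, ?_, hv⟩
    change Ψ (Ω v) = wick a b (hΨ.classical v)
    rw [hΩ v r f hv, hv, wick_tmul_expFun_eq_ofQ_mul]
  obtain ⟨v, hv, hvu⟩ := htrig (hΨ.classical_mem_trigSymb u)
  rw [← hΨ.classical_injective hvu]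
  exact hv

theorem existsUnique_isCentralOrdering (hΨ : IsHeisenbergCoord Ψ) :
    ∃! Ω, IsCentralOrdering hΨ Ω := by
  simp only [isCentralOrdering_iff]
  choose Ω hΩ using fun u => hΨ.exists_eq_wick (hΨ.classical_mem_trigSymb u)
  refine ⟨{ toFun := Ω
            map_add' := fun u v => hΨ.injective ?_
            map_smul' := fun c u => hΨ.injective ?_ }, hΩ,
    fun Ω' hΩ' => LinearMap.ext fun u => hΨ.injective ((hΩ' u).trans (hΩ u).symm)⟩
  · rw [map_add, hΩ, hΩ, hΩ, map_add, map_add]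
  · rw [map_smul, hΩ, hΩ, map_smul, map_smul, RingHom.id_apply]

namespace IsCentralOrdering

variable {hΨ : IsHeisenbergCoord Ψ} {Ω : SurfAlg.Classical ρ →ₗ[ℂ] SurfAlg ρ}

theorem map_eq_wick (hΩ : IsCentralOrdering hΨ Ω) (u : SurfAlg.Classical ρ) :
    Ψ (Ω u) = wick a b (hΨ.classical u) :=
  (isCentralOrdering_iff hΨ Ω).mp hΩ u

theorem isOrdering (hΩ : IsCentralOrdering hΨ Ω) : IsOrdering Ω := by
  have hsection (u : SurfAlg.Classical ρ) : SurfAlg.toClassical ρ (Ω u) = u :=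
    hΨ.classical_injective <| by
      rw [hΨ.classical_toClassical_eq_coeff, hΩ.map_eq_wick, coeff_zero_wick]
  exact ⟨Function.LeftInverse.injective hsection, hsection,
    hΨ.injective (by rw [hΩ.map_eq_wick, map_one hΨ.classical, wick_one, map_one])⟩

theorem isEpsExpansion_iff (hΩ : IsCentralOrdering hΨ Ω) {x : SurfAlg ρ}
    {C : ℕ → SurfAlg.Classical ρ} :
    IsEpsExpansion Ω x C ↔ Ψ x = wickSeries fun k => hΨ.classical (C k) := by
  rw [eq_wickSeries_iff]
  refine forall_congr' fun N => ?_
  rw [hΨ.exists_eq_add_eps_pow_mul_iff]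
  simp only [map_sum, map_mul, map_pow, hΨ.map_eps, hΩ.map_eq_wick]

theorem isStarProduct_iff (hΩ : IsCentralOrdering hΨ Ω) {u v : SurfAlg.Classical ρ}
    {C : ℕ → SurfAlg.Classical ρ} : IsStarProduct Ω u v C ↔
      ∀ k, hΨ.classical (C k) = veyCoeff k (hΨ.classical u) (hΨ.classical v) := by
  rw [IsStarProduct, hΩ.isEpsExpansion_iff, map_mul, hΩ.map_eq_wick, hΩ.map_eq_wick,
    wick_mul_wick, wickSeries_injective.eq_iff, eq_comm, funext_iff]

theorem existsUnique_isStarProduct (hΩ : IsCentralOrdering hΨ Ω) (u v : SurfAlg.Classical ρ) :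
    ∃! C, IsStarProduct Ω u v C := by
  simp only [hΩ.isStarProduct_iff]
  choose C hC using fun k => hΨ.exists_classical_eq (veyCoeff_mem_trigSymb
    (hΨ.classical_mem_trigSymb u) (hΨ.classical_mem_trigSymb v) k)
  exact ⟨C, hC, fun C' hC' => funext fun k =>
    hΨ.classical_injective ((hC' k).trans (hC k).symm)⟩

end IsCentralOrdering

end Coordinates

theorem mainTheorem9_general {a b : EReal} {ρ : (AnFun a b)⟦X⟧}
    (hρ : IsPosFun (PowerSeries.constantCoeff ρ)) :
    (∃! Ω_W : Symb a b →ₗ[ℂ] Heis a b, IsWickOrdering Ω_W) ∧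
    (∃! Ψ : SurfAlg ρ →ₐ[ℂ] Heis a b, IsHeisenbergCoord Ψ) ∧
    ∀ (Ω_W : Symb a b →ₗ[ℂ] Heis a b) (_ : IsWickOrdering Ω_W)
      (Ψ : SurfAlg ρ →ₐ[ℂ] Heis a b) (hΨ : IsHeisenbergCoord Ψ),
      Function.Injective Ψ ∧ Function.Injective hΨ.classical ∧
      (∃! Ω_C, IsCentralOrdering hΨ Ω_C) ∧
      ∀ Ω_C, IsCentralOrdering hΨ Ω_C →
        IsOrdering Ω_C ∧
        (∀ u, Ψ (Ω_C u) = Ω_W (hΨ.classical u)) ∧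
        (∀ x y, ∃ w, x * y - y * x = Complex.I • (SurfAlg.eps _ * w) ∧
          ∀ w', x * y - y * x = Complex.I • (SurfAlg.eps _ * w') →
            hΨ.classical (SurfAlg.toClassical _ w') =
              biPow 1 (hΨ.classical (SurfAlg.toClassical _ x))
                (hΨ.classical (SurfAlg.toClassical _ y))) ∧
        (∀ u v, (∃! C, IsStarProduct Ω_C u v C) ∧
          ∀ C, IsStarProduct Ω_C u v C →
            ∀ k, hΨ.classical (C k) = veyCoeff k (hΨ.classical u) (hΨ.classical v)) := by
  have hWick := wick_isWickOrdering a b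
  obtain ⟨τ, hτ⟩ : ∃ τ, IsPosSqrt τ (epsShift (1 / 2) ρ) :=
    IsPosFun.exists_isPosSqrt (by rwa [constantCoeff_epsShift])
  have hCoord := isHeisenbergCoord_heisCoord hτ
  refine ⟨⟨wick a b, hWick, fun _ hΩ => hΩ.unique hWick⟩,
    ⟨heisCoord hτ.1, hCoord, fun _ hΨ => hΨ.unique hCoord⟩, fun Ω_W hW Ψ hΨ => ?_⟩
  obtain rfl := hW.unique hWick
  refine ⟨hΨ.injective, hΨ.classical_injective, existsUnique_isCentralOrdering hΨ,
    fun Ω_C hΩ => ⟨hΩ.isOrdering, hΩ.map_eq_wick, fun x y => ?_, fun u v =>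
      ⟨hΩ.existsUnique_isStarProduct u v, fun _ hC => hΩ.isStarProduct_iff.mp hC⟩⟩⟩
  obtain ⟨w, hw⟩ := hΨ.exists_commutator_eq x y
  exact ⟨w, hw, fun _ hw' => hΨ.classical_commutator hw'⟩

theorem mainTheorem9 (a b : EReal) (hab : a < b) (ρ : ℝ → ℝ → ℝ)
    (hρ : ∀ z ∈ realIoo a b, AnalyticAt ℝ (fun x : ℝ × ℝ => ρ x.1 x.2) (z, 0))
    (hpos : ∀ z ∈ realIoo a b, 0 < ρ z 0) :
    (∃! Ω_W : Symb a b →ₗ[ℂ] Heis a b, IsWickOrdering Ω_W) ∧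
    (∃! Ψ : SurfAlg (epsTaylor ρ hρ) →ₐ[ℂ] Heis a b, IsHeisenbergCoord Ψ) ∧
    ∀ (Ω_W : Symb a b →ₗ[ℂ] Heis a b) (_ : IsWickOrdering Ω_W)
      (Ψ : SurfAlg (epsTaylor ρ hρ) →ₐ[ℂ] Heis a b) (hΨ : IsHeisenbergCoord Ψ),
      Function.Injective Ψ ∧ Function.Injective hΨ.classical ∧
      (∃! Ω_C, IsCentralOrdering hΨ Ω_C) ∧
      ∀ Ω_C, IsCentralOrdering hΨ Ω_C →
        IsOrdering Ω_C ∧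
        -- the central ordering is compatible with the Wick ordering
        (∀ u, Ψ (Ω_C u) = Ω_W (hΨ.classical u)) ∧
        -- `P` is the Poisson bracket `{π x, π y} = π ([x, y] / (iε))`
        (∀ x y, ∃ w, x * y - y * x = Complex.I • (SurfAlg.eps _ * w) ∧
          ∀ w', x * y - y * x = Complex.I • (SurfAlg.eps _ * w') →
            hΨ.classical (SurfAlg.toClassical _ w') =
              biPow 1 (hΨ.classical (SurfAlg.toClassical _ x))
                (hΨ.classical (SurfAlg.toClassical _ y))) ∧
        -- the star product of the central ordering is the Vey product
        (∀ u v, (∃! C, IsStarProduct Ω_C u v C) ∧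
          ∀ C, IsStarProduct Ω_C u v C →
            ∀ k, hΨ.classical (C k) = veyCoeff k (hΨ.classical u) (hΨ.classical v)) :=
  mainTheorem9_general (isPosFun_constantCoeff_epsTaylor hρ hpos)
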